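/- Let $K$ be a field of characteristic $0$, let $V$ be a vector space over $K$ of finite dimension $s$, and let $X=(a_1,\dots,a_N)$ be a list (repetitions allowed) of non-zero vectors of $V$ that spans $V$. Sublists of $X$ are identified with subsets of $\{1,\dots,N\}$. Let $S[V]$ be the symmetric algebra of $V$, graded by polynomial degree, and put $d_X=\prod_{a\in X}a\in S[V]$ and $R_X=S[V][d_X^{-1}]$. For $k\in\mathbb Z$ let $R_{X,k}\subseteq R_X$ be the span of all fractions $f\prod_{a\in X}a^{-h_a}$, with $f\in S[V]$ and integers $h_a\ge 0$, such that the vectors $a$ with $h_a>0$ span a space of dimension $\le k$. Let $P_X=R_X/R_{X,s-1}$ be the $S[V]$-module of polar parts, let $u_X\in P_X$ be the class of $d_X^{-1}$, and let $Q_X=S[V]\,u_X\subseteq P_X$. Grade $P_X$ by the degree of rational functions shifted by $N$, so that $u_X$ has degree $0$, and give $Q_X$ the induced grading. A sublist $Y\subseteq X$ is a cocircuit if $X-Y$ does not span $V$; let $I_X\subseteq S[V]$ be the ideal generated by the products $M_Y=\prod_{x\in Y}x$, where $Y$ runs over the cocircuits, and let $A_X=S[V]/I_X$ with the grading induced from $S[V]$.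 For a basis $\underline b=(a_{i_1},\dots,a_{i_s})$, $i_1<\dots<i_s$, of $V$ extracted from $X$, let $B(\underline b)$ be the sublist of all $a_i\in X$ that break $\underline b$, that is, for which there is an index $e$ with $i\le i_e$ such that $a_i$ lies in the span of $a_{i_e},\dots,a_{i_s}$. Then: 1. The annihilator of $u_X$ in $S[V]$ is exactly $I_X$. The modules $A_X$ and $Q_X$ are the direct sums of their homogeneous components, and $f\mapsto f\,u_X$ induces an isomorphism $A_X\simeq Q_X$ of graded $S[V]$-modules. 2. The elements $u_{\underline b}:=\bigl(\prod_{a\in X-B(\underline b)}a\bigr)u_X$, for $\underline b$ running over the bases extracted from $X$, form a basis of the $K$-vector space $Q_X$. -/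

import Mathlib

namespace PolarParts

noncomputable section

variable {K V : Type*} [Field K] [AddCommGroup V] [Module K V] {N : ℕ}

/-- The symmetric algebra `S[V]`, i.e. the ring of polynomial functions on `U = V*`. -/
abbrev Sym (K V : Type*) [Field K] [AddCommGroup V] [Module K V] : Type _ :=
  SymmetricAlgebra K V

/-- For a sublist `Y` of `X` (a set of positions), the product `M_Y = ∏_{x ∈ Y} x` in `S[V]`. -/
def prodOf (X : Fin N → V) (Y : Finset (Fin N)) : Sym K V :=
  ∏ i ∈ Y, SymmetricAlgebra.ι K V (X i)

/-- `d_X = ∏_{a ∈ X} a`. -/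
def dX (X : Fin N → V) : Sym K V := prodOf X Finset.univ

/-- A sublist `Y` of `X` is a cocircuit if the elements of `X - Y` do not span `V`. -/
def IsCocircuit (K : Type*) {V : Type*} [Field K] [AddCommGroup V] [Module K V] {N : ℕ}
    (X : Fin N → V) (Y : Finset (Fin N)) : Prop :=
  Submodule.span K (X '' {i | i ∉ Y}) ≠ ⊤

/-- The ideal `I_X` generated by the products `M_Y`, `Y` a cocircuit. -/
def cocircuitIdeal (X : Fin N → V) : Ideal (Sym K V) :=
  Ideal.span {m | ∃ Y : Finset (Fin N), IsCocircuit K X Y ∧ m = prodOf X Y}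

/-- The algebra `A_X = S[V] / I_X`. -/
abbrev AX (K : Type*) {V : Type*} [Field K] [AddCommGroup V] [Module K V] {N : ℕ}
    (X : Fin N → V) : Type _ :=
  Sym K V ⧸ (cocircuitIdeal X : Ideal (Sym K V))

/-- A sublist `b` of `X` is a basis of `V` extracted from `X`. -/
def IsExtractedBasis (K : Type*) {V : Type*} [Field K] [AddCommGroup V] [Module K V] {N : ℕ}
    (X : Fin N → V) (b : Finset (Fin N)) : Prop :=
  LinearIndepOn K X (b : Set (Fin N)) ∧ Submodule.span K (X '' (b : Set (Fin N))) = ⊤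

/-- The element at position `i` breaks the sublist `c`: for some position `e` of `c` with `i ≤ e`,
it is linearly dependent on the elements of `c` from position `e` onwards. -/
def Breaks (K : Type*) {V : Type*} [Field K] [AddCommGroup V] [Module K V] {N : ℕ}
    (X : Fin N → V) (c : Finset (Fin N)) (i : Fin N) : Prop :=
  ∃ e ∈ c, i ≤ e ∧ X i ∈ Submodule.span K (X '' {j | j ∈ c ∧ e ≤ j})

open Classical in
/-- `B(b)`, the sublist of all elements of `X` that break `b`. -/
def breakSet (K : Type*) {V : Type*} [Field K] [AddCommGroup V] [Module K V] {N : ℕ}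
    (X : Fin N → V) (b : Finset (Fin N)) : Finset (Fin N) :=
  Finset.univ.filter (Breaks K X b)

/-- The ring `R_X = S[V][d_X⁻¹]`. -/
abbrev RX (K : Type*) {V : Type*} [Field K] [AddCommGroup V] [Module K V] {N : ℕ}
    (X : Fin N → V) : Type _ :=
  Localization.Away (dX X : Sym K V)

/-- The filtration by polar order: `R_{X,k}` is the submodule of `R_X` spanned by the fractions
`f ∏_a a ^ (-h_a)` for which the vectors `a` with `h_a > 0` span a space of dimension `≤ k`. Each
`a ∈ X` is a unit of `R_X`, so the fraction `x` is determined by `x * ∏_a a ^ h_a = f`.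
The index `k` is an integer, so that `R_{X,-1} = 0`. -/
def polarFiltration (K : Type*) {V : Type*} [Field K] [AddCommGroup V] [Module K V] {N : ℕ}
    (X : Fin N → V) (k : ℤ) : Submodule (Sym K V) (RX K X) :=
  Submodule.span (Sym K V)
    {x | ∃ (f : Sym K V) (h : Fin N → ℕ),
      (Module.finrank K (Submodule.span K (X '' {i | 0 < h i})) : ℤ) ≤ k ∧
      x * algebraMap (Sym K V) (RX K X) (∏ i, SymmetricAlgebra.ι K V (X i) ^ h i) =
        algebraMap (Sym K V) (RX K X) f}

/-- The module of polar parts `P_X = R_X / R_{X,s-1}`, where `s = dim V`. -/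
abbrev PX (K : Type*) {V : Type*} [Field K] [AddCommGroup V] [Module K V] {N : ℕ}
    (X : Fin N → V) : Type _ :=
  RX K X ⧸ polarFiltration K X ((Module.finrank K V : ℤ) - 1)

/-- `u_X`, the class of `1 / d_X` in `P_X`. -/
def uX (K : Type*) {V : Type*} [Field K] [AddCommGroup V] [Module K V] {N : ℕ}
    (X : Fin N → V) : PX K X :=
  (polarFiltration K X ((Module.finrank K V : ℤ) - 1)).mkQ
    (IsLocalization.Away.invSelf (dX X : Sym K V))

/-- `Q_X`, the `S[V]`-submodule of `P_X` generated by `u_X`. -/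
def QX (K : Type*) {V : Type*} [Field K] [AddCommGroup V] [Module K V] {N : ℕ}
    (X : Fin N → V) : Submodule (Sym K V) (PX K X) :=
  Submodule.span (Sym K V) {uX K X}

/-- `u_b = (∏_{a ∈ X - B(b)} a) u_X`. -/
def uBasis (K : Type*) {V : Type*} [Field K] [AddCommGroup V] [Module K V] {N : ℕ}
    (X : Fin N → V) (b : Finset (Fin N)) : PX K X :=
  (prodOf X (breakSet K X b)ᶜ : Sym K V) • uX K X

/-- The homogeneous polynomials of degree `j` in `S[V]` (zero for `j < 0`). -/
def symDegree (K V : Type*) [Field K] [AddCommGroup V] [Module K V] (j : ℤ) :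
    Submodule K (Sym K V) :=
  if 0 ≤ j then LinearMap.range (SymmetricAlgebra.ι K V) ^ j.toNat else ⊥

/-- The degree `j` part of `A_X`: the classes of the homogeneous polynomials of degree `j`. -/
def AXDegree (K : Type*) {V : Type*} [Field K] [AddCommGroup V] [Module K V] {N : ℕ}
    (X : Fin N → V) (j : ℤ) : Submodule K (AX K X) :=
  (symDegree K V j).map (Ideal.Quotient.mkₐ K (cocircuitIdeal X : Ideal (Sym K V))).toLinearMap

/-- The part of `R_X` of degree `j` as functions: the fractions `f / d_X ^ m` with `f` homogeneous
of degree `j + m N`. -/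
def RXDegree (K : Type*) {V : Type*} [Field K] [AddCommGroup V] [Module K V] {N : ℕ}
    (X : Fin N → V) (j : ℤ) : Submodule K (RX K X) :=
  Submodule.span K
    {x | ∃ (m : ℕ), ∃ f ∈ symDegree K V (j + m * N),
      x * algebraMap (Sym K V) (RX K X) (dX X ^ m) = algebraMap (Sym K V) (RX K X) f}

/-- The degree `j` part of `P_X`, where the degree as functions is shifted by `N`, so that
`u_X` has degree `0`. -/
def PXDegree (K : Type*) {V : Type*} [Field K] [AddCommGroup V] [Module K V] {N : ℕ}
    (X : Fin N → V) (j : ℤ) : Submodule K (PX K X) :=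
  (RXDegree K X (j - N)).map
    ((polarFiltration K X ((Module.finrank K V : ℤ) - 1)).mkQ.restrictScalars K)

/-- The degree `j` part of `Q_X`: the elements of `Q_X` that have degree `j` in `P_X`. -/
def QXDegree (K : Type*) {V : Type*} [Field K] [AddCommGroup V] [Module K V] {N : ℕ}
    (X : Fin N → V) (j : ℤ) : Submodule K (QX K X) :=
  (PXDegree K X j).comap ((QX K X).subtype.restrictScalars K)

end

end PolarParts

namespace PolarParts

noncomputable section

variable {K V : Type*} [Field K] [AddCommGroup V] [Module K V] {N : ℕ}

open scoped LaurentSeries PowerSeries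

/-! Three facts carry the proof. First, `I_X` kills `u_X`: for a cocircuit `Y`, the fraction `M_Y /
d_X` has only the vectors of `X - Y` in its denominator, and these do not span
(`cocircuitIdeal_le_torsionOf`). Second, the monomials `∏_{a ∈ X - B(b)} a` span `S[V]` modulo `I_X`
(`relMonomialSpan_sup_relCocircuitIdeal`). Third, the elements `u_b` are linearly independent in
`P_X` (`eq_zero_of_sum_polarTerm_mem`, `linearIndependent_uBasis`). Hence `A_X → Q_X` sends a
spanning family to a basis, so it is an isomorphism and the annihilator is no larger than `I_X`.

Spanning is a deletion-contraction induction on the last vector `a`. To contract without leaving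
`S[V]`, everything is stated modulo a subspace `W`, and contraction enlarges `W` by `a`.

Independence uses that `u_b` is the class of the inverse of the product of `B(b)`. Let `M` be the
largest position in the bases of a relation, and expand along the hyperplane `x M = 0` in a Laurent
variable `t`. The bases containing `M` have the largest pole, of a common order. Its coefficient is
a relation of the same kind for the family projected along `x M`, while functions of lower polar
order keep lower polar order. Induction on the dimension of the span concludes. Projected families
contain zero vectors, so the induction allows them.

For the gradings, the automorphism `v ↦ 2 v` acts on degree `j` of `R_X` as `2 ^ j`. These scalars
are distinct in characteristic 0, so the pieces of `P_X` lie in distinct eigenspaces; characteristic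
0 is needed only there. -/

/-! ### Spanning modulo the cocircuit ideal, by deletion and contraction -/

/-- The ideal of `S[V]` generated by a subspace `W` of `V`. -/
def subspaceIdeal (W : Submodule K V) : Ideal (Sym K V) :=
  Ideal.span (SymmetricAlgebra.ι K V '' W)

/-- The cocircuit ideal of the sublist `T` in the contraction `V / W`, lifted to `S[V]`. -/
def relCocircuitIdeal (X : Fin N → V) (T : Finset (Fin N)) (W : Submodule K V) :
    Ideal (Sym K V) :=
  subspaceIdeal W ⊔ Ideal.span {m | ∃ Y ⊆ T,
    W ⊔ Submodule.span K (X '' {i | i ∈ T ∧ i ∉ Y}) ≠ ⊤ ∧ m = prodOf X Y}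

/-- The position `i` breaks `b` in the contraction `V / W`; vectors of `W` always do. -/
def RelBreaks (X : Fin N → V) (W : Submodule K V) (b : Finset (Fin N)) (i : Fin N) : Prop :=
  X i ∈ W ∨ ∃ e ∈ b, i ≤ e ∧ X i ∈ W ⊔ Submodule.span K (X '' {j | j ∈ b ∧ e ≤ j})

open Classical in
/-- The product of the elements of the sublist `T` that do not break `b` modulo `W`. -/
def relMonomial (X : Fin N → V) (T : Finset (Fin N)) (W : Submodule K V) (b : Finset (Fin N)) :
    Sym K V :=
  prodOf X (T.filter fun i => ¬ RelBreaks X W b i)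

/-- `b` is a basis of `V` modulo `W`: it spans and has at most `dim V - dim W` elements. -/
def IsRelBasis (X : Fin N → V) (W : Submodule K V) (b : Finset (Fin N)) : Prop :=
  Module.finrank K W + b.card ≤ Module.finrank K V ∧
    W ⊔ Submodule.span K (X '' (b : Set (Fin N))) = ⊤

theorem algebraMap_add_subspaceIdeal_top (f : Sym K V) :
    ∃ c : K, f - algebraMap K _ c ∈ subspaceIdeal (⊤ : Submodule K V) := by
  induction f using SymmetricAlgebra.induction with
  | algebraMap r => exact ⟨r, by simp⟩
  | ι v => 
    refine ⟨0, ?_⟩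
    rw [map_zero, sub_zero]
    exact Ideal.subset_span ⟨v, trivial, rfl⟩
  | mul f g hf hg =>
    obtain ⟨c, hc⟩ := hf
    obtain ⟨d, hd⟩ := hg
    refine ⟨c * d, ?_⟩
    have : f * g - algebraMap K (Sym K V) (c * d) =
        g * (f - algebraMap K _ c) + algebraMap K _ c * (g - algebraMap K _ d) := by
      rw [map_mul]; ring
    rw [this]
    exact Ideal.add_mem _ (Ideal.mul_mem_left _ _ hc) (Ideal.mul_mem_left _ _ hd)
  | add f g hf hg =>
    obtain ⟨c, hc⟩ := hf
    obtain ⟨d, hd⟩ := hg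
    refine ⟨c + d, ?_⟩
    rw [map_add, add_sub_add_comm]
    exact Ideal.add_mem _ hc hd

theorem subspaceIdeal_sup_span_singleton (W : Submodule K V) (a : V) :
    subspaceIdeal (W ⊔ Submodule.span K {a}) ≤
      subspaceIdeal W ⊔ Ideal.span {SymmetricAlgebra.ι K V a} := by
  rw [subspaceIdeal, Ideal.span_le]
  rintro _ ⟨v, hv, rfl⟩
  obtain ⟨w, hw, z, hz, rfl⟩ := Submodule.mem_sup.1 hv
  obtain ⟨c, rfl⟩ := Submodule.mem_span_singleton.1 hz
  rw [map_add, map_smul]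
  refine Ideal.add_mem _ (Ideal.mem_sup_left (Ideal.subset_span ⟨w, hw, rfl⟩))
    (Ideal.mem_sup_right ?_)
  rw [Algebra.smul_def]
  exact Ideal.mul_mem_left _ _ (Ideal.subset_span rfl)

/-- The monomials of the relative bases contained in `T`. -/
def relMonomialSpan (X : Fin N → V) (T : Finset (Fin N)) (W : Submodule K V) :
    Submodule K (Sym K V) :=
  Submodule.span K {m | ∃ b ⊆ T, IsRelBasis X W b ∧ m = relMonomial X T W b}

theorem isRelBasis_insert [FiniteDimensional K V] {X : Fin N → V} {W : Submodule K V} {a : Fin N}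
    {b : Finset (Fin N)} (ha : a ∉ b) (haW : X a ∉ W)
    (hb : IsRelBasis X (W ⊔ Submodule.span K {X a}) b) : IsRelBasis X W (insert a b) := by
  refine ⟨?_, ?_⟩
  · have hlt : W < W ⊔ Submodule.span K {X a} :=
      left_lt_sup.2 fun h => haW (h (Submodule.mem_span_singleton_self _))
    have := Submodule.finrank_lt_finrank_of_lt hlt
    have := hb.1
    rw [Finset.card_insert_of_notMem ha]
    omega
  · rw [Finset.coe_insert, Set.image_insert_eq, Submodule.span_insert, ← sup_assoc]
    exact hb.2

/-- Every tail of `insert a b` contains its last element `a`, so `X a` can be moved into `W`. The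
tail `{a}` itself corresponds to the alternative `X i ∈ W` in `RelBreaks`. -/
theorem relBreaks_insert_iff {X : Fin N → V} {W : Submodule K V} {a : Fin N} {b : Finset (Fin N)}
    (hba : ∀ j ∈ b, j < a) {i : Fin N} (hi : i < a) :
    RelBreaks X W (insert a b) i ↔ RelBreaks X (W ⊔ Submodule.span K {X a}) b i := by
  have hset : ∀ e ∈ b, {j | j ∈ insert a b ∧ e ≤ j} = insert a {j | j ∈ b ∧ e ≤ j} := by
    intro e he
    ext j
    have := hba e he
    simp only [Finset.mem_insert, Set.mem_ofPred_eq, Set.mem_insert_iff]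
    constructor
    · rintro ⟨rfl | h, h'⟩ <;> tauto
    · rintro (rfl | h)
      · exact ⟨Or.inl rfl, this.le⟩
      · tauto
  have hseta : {j | j ∈ insert a b ∧ a ≤ j} = {a} := by
    ext j
    simp only [Finset.mem_insert, Set.mem_ofPred_eq, Set.mem_singleton_iff]
    constructor
    · rintro ⟨rfl | h, h'⟩
      · rfl
      · exact absurd (hba j h) (not_lt.2 h')
    · rintro rfl
      exact ⟨Or.inl rfl, le_rfl⟩
  unfold RelBreaks
  constructor
  · rintro (h | ⟨e, he, hie, h⟩)
    · exact Or.inl (Submodule.mem_sup_left h)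
    · obtain rfl | he := Finset.mem_insert.1 he
      · rw [hseta, Set.image_singleton] at h
        exact Or.inl h
      · rw [hset e he, Set.image_insert_eq, Submodule.span_insert, ← sup_assoc] at h
        exact Or.inr ⟨e, he, hie, h⟩
  · rintro (h | ⟨e, he, hie, h⟩)
    · refine Or.inr ⟨a, Finset.mem_insert_self _ _, hi.le, ?_⟩
      rwa [hseta, Set.image_singleton]
    · refine Or.inr ⟨e, Finset.mem_insert_of_mem he, hie, ?_⟩
      rwa [hset e he, Set.image_insert_eq, Submodule.span_insert, ← sup_assoc]

-- Contraction: a basis modulo `W + X a` is completed by `a`, and since `a` breaks the new basis the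
-- monomial does not change.
open Classical in
theorem relMonomialSpan_le_insert [FiniteDimensional K V] {X : Fin N → V} {W : Submodule K V}
    {a : Fin N} {s : Finset (Fin N)} (hs : ∀ j ∈ s, j < a) (ha : X a ∉ W) :
    relMonomialSpan X s (W ⊔ Submodule.span K {X a}) ≤ relMonomialSpan X (insert a s) W := by
  rw [relMonomialSpan, Submodule.span_le]
  rintro _ ⟨b, hbs, hb, rfl⟩
  have hab : a ∉ b := fun h => lt_irrefl _ (hs a (hbs h))
  refine Submodule.subset_span
    ⟨insert a b, Finset.insert_subset_insert _ hbs, isRelBasis_insert hab ha hb, ?_⟩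
  unfold relMonomial
  congr 1
  have hbreak : RelBreaks X W (insert a b) a :=
    Or.inr ⟨a, by simp, le_rfl, Submodule.mem_sup_right (Submodule.subset_span ⟨a, by simp, rfl⟩)⟩
  rw [Finset.filter_insert, if_neg (by simpa using hbreak)]
  refine Finset.filter_congr fun i hi => ?_
  rw [relBreaks_insert_iff (fun j hj => hs j (hbs hj)) (hs i hi)]

/-- A cocircuit `Y` of the contraction avoids `a`, so after adding `a` its complement contains `a`
and spans, with `W`, the same proper subspace. -/
theorem relCocircuitIdeal_sup_span_singleton {X : Fin N → V} {W : Submodule K V}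
    {a : Fin N} {s : Finset (Fin N)} (hs : a ∉ s) :
    relCocircuitIdeal X s (W ⊔ Submodule.span K {X a}) ≤
      relCocircuitIdeal X (insert a s) W ⊔ Ideal.span {SymmetricAlgebra.ι K V (X a)} := by
  refine sup_le ((subspaceIdeal_sup_span_singleton W (X a)).trans
    (sup_le_sup_right le_sup_left _)) ?_
  rw [Ideal.span_le]
  rintro _ ⟨Y, hY, hne, rfl⟩
  refine Ideal.mem_sup_left (Ideal.mem_sup_right (Ideal.subset_span
    ⟨Y, hY.trans (Finset.subset_insert _ _), ?_, rfl⟩))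
  have : {i | i ∈ insert a s ∧ i ∉ Y} = insert a {i | i ∈ s ∧ i ∉ Y} := by
    ext i
    have : a ∉ Y := fun h => hs (hY h)
    simp only [Finset.mem_insert, Set.mem_ofPred_eq, Set.mem_insert_iff]
    constructor
    · tauto
    · rintro (rfl | h) <;> tauto
  rwa [this, Set.image_insert_eq, Submodule.span_insert, ← sup_assoc]

open Classical in
-- Deletion: `a` comes after all of `b` and is not in `W`, so it does not break `b`, and the
-- monomial gains exactly the factor `X a`.
theorem ι_mul_mem_relMonomialSpan {X : Fin N → V} {W : Submodule K V}
    {a : Fin N} {s : Finset (Fin N)} (hs : ∀ j ∈ s, j < a) (ha : X a ∉ W)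
    {f : Sym K V} (hf : f ∈ relMonomialSpan X s W) :
    SymmetricAlgebra.ι K V (X a) * f ∈ relMonomialSpan X (insert a s) W := by
  induction hf using Submodule.span_induction with
  | zero => simp
  | add f g _ _ hf hg => rw [mul_add]; exact Submodule.add_mem _ hf hg
  | smul c f _ hf => rw [mul_smul_comm]; exact Submodule.smul_mem _ _ hf
  | mem f hf =>
    obtain ⟨b, hbs, hb, rfl⟩ := hf
    refine Submodule.subset_span ⟨b, hbs.trans (Finset.subset_insert _ _), hb, ?_⟩
    have hbreak : ¬ RelBreaks X W b a := by
      rintro (h | ⟨e, he, hae, -⟩)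
      · exact ha h
      · exact absurd (hs e (hbs he)) (not_lt.2 hae)
    unfold relMonomial prodOf
    rw [Finset.filter_insert, if_pos hbreak, Finset.prod_insert]
    intro h
    exact lt_irrefl _ (hs a (Finset.mem_filter.1 h).1)

theorem ι_mul_mem_relCocircuitIdeal {X : Fin N → V} {W : Submodule K V}
    {a : Fin N} {s : Finset (Fin N)} (hs : a ∉ s)
    {f : Sym K V} (hf : f ∈ relCocircuitIdeal X s W) :
    SymmetricAlgebra.ι K V (X a) * f ∈ relCocircuitIdeal X (insert a s) W := by
  obtain ⟨g, hg, h, hh, rfl⟩ := Submodule.mem_sup.1 hf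
  rw [mul_add]
  refine Ideal.add_mem _ (Ideal.mem_sup_left (Ideal.mul_mem_left _ _ hg)) (Ideal.mem_sup_right ?_)
  clear hf
  induction hh using Submodule.span_induction with
  | zero => simp
  | add f g _ _ hf hg => rw [mul_add]; exact Ideal.add_mem _ hf hg
  | smul c f _ hf => rw [mul_smul_comm]; exact Ideal.mul_mem_left _ _ hf
  | mem f hf =>
    obtain ⟨Y, hY, hne, rfl⟩ := hf
    refine Ideal.subset_span ⟨insert a Y, Finset.insert_subset_insert _ hY, ?_, ?_⟩
    · have : {i | i ∈ insert a s ∧ i ∉ insert a Y} = {i | i ∈ s ∧ i ∉ Y} := by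
        ext i
        simp only [Finset.mem_insert, Set.mem_ofPred_eq]
        constructor
        · tauto
        · rintro ⟨h1, h2⟩
          have : i ≠ a := by rintro rfl; exact hs h1
          tauto
      rwa [this]
    · unfold prodOf
      rw [Finset.prod_insert fun h => hs (hY h)]

-- Write `A(T, W)` for the quotient by `relCocircuitIdeal X T W`. When `X a ∉ W`, multiplication by
-- `X a` gives a right exact sequence `A(s, W) → A(insert a s, W) → A(s, W + X a) → 0`; generators
-- of the two outer terms lift to generators of the middle one.
open Classical in
theorem relMonomialSpan_sup_relCocircuitIdeal [FiniteDimensional K V] (X : Fin N → V)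
    (T : Finset (Fin N)) (W : Submodule K V) :
    relMonomialSpan X T W ⊔ (relCocircuitIdeal X T W).restrictScalars K = ⊤ := by
  induction T using Finset.induction_on_max generalizing W with
  | empty =>
    rw [eq_top_iff]
    intro f _
    by_cases hW : W = ⊤
    · subst hW
      obtain ⟨c, hc⟩ := algebraMap_add_subspaceIdeal_top f
      rw [← add_sub_cancel (algebraMap K _ c) f]
      refine Submodule.add_mem_sup ?_ (Ideal.mem_sup_left hc)
      rw [Algebra.algebraMap_eq_smul_one]
      exact Submodule.smul_mem _ _ (Submodule.subset_span
        ⟨∅, subset_rfl, ⟨by simp, by simp⟩, by simp [relMonomial, prodOf]⟩)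
    -- When `W` is proper and no vectors remain, the empty set is a cocircuit and the ideal is the
    -- whole ring.
    · refine Submodule.mem_sup_right (Ideal.mem_sup_right ?_)
      rw [← mul_one f]
      exact Ideal.mul_mem_left _ _ (Ideal.subset_span
        ⟨∅, subset_rfl, by simpa using hW, by simp [prodOf]⟩)
  | insert a s hs ih =>
    have has : a ∉ s := fun h => lt_irrefl _ (hs a h)
    rw [eq_top_iff]
    -- A vector of `W` is a loop: it breaks every `b` and does not affect spans modulo `W`, so it
    -- can be dropped.
    by_cases ha : X a ∈ W
    · rw [← ih W]
      refine sup_le_sup ?_ ?_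
      · refine Submodule.span_mono ?_
        rintro _ ⟨b, hbs, hb, rfl⟩
        refine ⟨b, hbs.trans (Finset.subset_insert _ _), hb, ?_⟩
        unfold relMonomial
        rw [Finset.filter_insert, if_neg (not_not.2 (show RelBreaks X W b a from Or.inl ha))]
      · change relCocircuitIdeal X s W ≤ relCocircuitIdeal X (insert a s) W
        refine sup_le_sup le_rfl (Ideal.span_mono ?_)
        rintro _ ⟨Y, hY, hne, rfl⟩
        refine ⟨Y, hY.trans (Finset.subset_insert _ _), fun h => hne ?_, rfl⟩
        rw [eq_top_iff, ← h]
        refine sup_le le_sup_left (Submodule.span_le.2 ?_)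
        rintro _ ⟨i, ⟨hi, hiY⟩, rfl⟩
        obtain rfl | hi := Finset.mem_insert.1 hi
        · exact Submodule.mem_sup_left ha
        · exact Submodule.mem_sup_right (Submodule.subset_span ⟨i, ⟨hi, hiY⟩, rfl⟩)
    · intro f _
      have hf : f ∈ relMonomialSpan X s (W ⊔ Submodule.span K {X a}) ⊔
          (relCocircuitIdeal X s (W ⊔ Submodule.span K {X a})).restrictScalars K := by
        rw [ih]; trivial
      obtain ⟨m, hm, r, hr, rfl⟩ := Submodule.mem_sup.1 hf
      refine Submodule.add_mem _ (Submodule.mem_sup_left (relMonomialSpan_le_insert hs ha hm)) ?_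
      obtain ⟨r₁, hr₁, r₂, hr₂, rfl⟩ :=
        Submodule.mem_sup.1 (relCocircuitIdeal_sup_span_singleton has hr)
      refine Submodule.add_mem _ (Submodule.mem_sup_right hr₁) ?_
      obtain ⟨g, rfl⟩ := Ideal.mem_span_singleton.1 hr₂
      have hg : g ∈ relMonomialSpan X s W ⊔ (relCocircuitIdeal X s W).restrictScalars K := by
        rw [ih]; trivial
      obtain ⟨m', hm', r', hr', rfl⟩ := Submodule.mem_sup.1 hg
      rw [mul_add]
      exact Submodule.add_mem_sup (ι_mul_mem_relMonomialSpan hs ha hm')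
        (ι_mul_mem_relCocircuitIdeal has hr')

open Classical in
/-- The monomials `∏_{a ∈ X - B(b)} a` span `S[V]` modulo the cocircuit ideal. -/
theorem span_prodOf_compl_breakSet_sup_cocircuitIdeal [FiniteDimensional K V] (X : Fin N → V)
    (hX0 : ∀ i, X i ≠ 0) :
    Submodule.span K (Set.range fun b : {b : Finset (Fin N) // IsExtractedBasis K X b} =>
        (prodOf X (breakSet K X b.1)ᶜ : Sym K V)) ⊔
      (cocircuitIdeal X : Ideal (Sym K V)).restrictScalars K = ⊤ := by
  rw [eq_top_iff, ← relMonomialSpan_sup_relCocircuitIdeal X Finset.univ ⊥]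
  refine sup_le_sup ?_ ?_
  · refine Submodule.span_mono ?_
    rintro _ ⟨b, -, hb, rfl⟩
    have hspan : Submodule.span K (X '' (b : Set (Fin N))) = ⊤ := by simpa using hb.2
    refine ⟨⟨b, ?_, hspan⟩, ?_⟩
    -- A spanning set with at most `dim V` elements is independent.
    · have hcard : b.card ≤ Module.finrank K V := by simpa using hb.1
      rw [LinearIndepOn, linearIndependent_iff_card_le_finrank_span]
      rw [Set.finrank, ← Set.image_eq_range, hspan]
      simpa using hcard
    · dsimp only [relMonomial]
      congr 1
      ext i
      rw [Finset.mem_filter]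
      simp [breakSet, RelBreaks, Breaks, hX0]
  · change relCocircuitIdeal X Finset.univ ⊥ ≤ cocircuitIdeal X
    refine sup_le ?_ (Ideal.span_mono ?_)
    · rw [subspaceIdeal, Ideal.span_le]
      rintro _ ⟨v, hv, rfl⟩
      rw [(Submodule.mem_bot K).1 hv, map_zero]
      exact Ideal.zero_mem _
    · rintro _ ⟨Y, -, hY, rfl⟩
      exact ⟨Y, by simpa [IsCocircuit] using hY, rfl⟩

/-! ### Laurent series and inverses of linear forms -/

section Laurent

variable {L : Type*} [Field L]

/-- The Laurent series all of whose coefficients lie in a subring `A`. -/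
def laurentSubring (A : Subring L) : Subring L⸨X⸩ where
  carrier := {f | ∀ n, f.coeff n ∈ A}
  zero_mem' n := by simp
  one_mem' n := by
    rw [HahnSeries.coeff_one]
    split_ifs <;> simp
  add_mem' hf hg n := by
    rw [HahnSeries.coeff_add]
    exact A.add_mem (hf n) (hg n)
  neg_mem' hf n := by
    rw [HahnSeries.coeff_neg]
    exact A.neg_mem (hf n)
  mul_mem' hf hg n := by
    rw [HahnSeries.coeff_mul]
    exact A.sum_mem fun _ _ => A.mul_mem (hf _) (hg _)

/-- The power series expansion of `1 / (u + c t)`. -/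
def linearInv (u c : L) : L⟦X⟧ := PowerSeries.mk fun n => (-c) ^ n * u⁻¹ ^ (n + 1)

theorem linear_mul_linearInv {u : L} (hu : u ≠ 0) (c : L) :
    (PowerSeries.C u + PowerSeries.C c * PowerSeries.X) * linearInv u c = 1 := by
  ext n
  rw [add_mul, map_add, mul_assoc, PowerSeries.coeff_C_mul, PowerSeries.coeff_C_mul]
  cases n with
  | zero => simp [linearInv, hu]
  | succ n =>
    rw [PowerSeries.coeff_succ_X_mul, PowerSeries.coeff_one, if_neg (Nat.succ_ne_zero n)]
    simp only [linearInv, PowerSeries.coeff_mk]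
    have h : u * u⁻¹ ^ (n + 1 + 1) = u⁻¹ ^ (n + 1) := by
      rw [pow_succ' _ (n + 1), mul_inv_cancel_left₀ hu]
    rw [mul_left_comm, h]
    ring

theorem inv_linear {u : L} (hu : u ≠ 0) (c : L) :
    (HahnSeries.C u + HahnSeries.single 1 c : L⸨X⸩)⁻¹ = (linearInv u c : L⸨X⸩) := by
  refine inv_eq_of_mul_eq_one_right ?_
  rw [← PowerSeries.coe_one, ← linear_mul_linearInv hu c, PowerSeries.coe_mul, PowerSeries.coe_add,
    PowerSeries.coe_mul, PowerSeries.coe_C, PowerSeries.coe_C, PowerSeries.coe_X]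
  congr 2
  simp [HahnSeries.C_apply, HahnSeries.single_mul_single]

theorem constantCoeff_linearInv (u c : L) : PowerSeries.constantCoeff (linearInv u c) = u⁻¹ := by
  rw [← PowerSeries.coeff_zero_eq_constantCoeff_apply]
  simp [linearInv]

theorem coe_mem_laurentSubring {A : Subring L} {f : L⟦X⟧} (hf : ∀ n, PowerSeries.coeff n f ∈ A) :
    (f : L⸨X⸩) ∈ laurentSubring A := by
  intro n
  rw [PowerSeries.coeff_coe]
  split_ifs
  · exact A.zero_mem
  · exact hf _

theorem single_mem_laurentSubring {A : Subring L} {n : ℤ} {c : L} (hc : c ∈ A) :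
    (HahnSeries.single n c : L⸨X⸩) ∈ laurentSubring A := by
  intro m
  rw [HahnSeries.coeff_single]
  split_ifs
  · exact hc
  · exact A.zero_mem

/-- The pole has order at most `q ≤ p`, so order `p` is reached only when `q = p`, where the leading
coefficient appears. -/
theorem coeff_neg_single_neg_mul_coe (p q : ℕ) (c : L) (f : L⟦X⟧) (hq : q ≤ p) :
    (HahnSeries.single (-(q : ℤ)) c * (f : L⸨X⸩)).coeff (-(p : ℤ)) =
      if q = p then c * PowerSeries.constantCoeff f else 0 := by
  rw [HahnSeries.coeff_single_mul, PowerSeries.coeff_coe]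
  split_ifs with h1 h2 h2
  · omega
  · simp
  · rw [show (-(p : ℤ) - -(q : ℤ)).natAbs = 0 by omega,
      PowerSeries.coeff_zero_eq_constantCoeff_apply]
  · omega

end Laurent

/-! ### Laurent expansion of rational functions along a hyperplane -/

section Expansion

variable (L : Type*) [Field L] [Algebra (Sym K V) L]

variable (K) in
/-- The element of the field `L` given by a vector. -/
def vec (v : V) : L := algebraMap (Sym K V) L (SymmetricAlgebra.ι K V v)

/-- The projection of `V` onto `ker lam` along `a`, when `lam a = 1`. -/
def projAlong (lam : V →ₗ[K] K) (a : V) : V →ₗ[K] V := LinearMap.id - lam.smulRight a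

theorem projAlong_apply (lam : V →ₗ[K] K) (a v : V) : projAlong lam a v = v - lam v • a := rfl

/-- The substitution `v ↦ π v + lam(v) t` of polynomials. -/
def splitHom (lam : V →ₗ[K] K) (a : V) : Sym K V →ₐ[K] Polynomial (Sym K V) :=
  SymmetricAlgebra.lift
    ((Polynomial.CAlgHom (R := K) (A := Sym K V)).toLinearMap ∘ₗ SymmetricAlgebra.ι K V ∘ₗ
        projAlong lam a +
      lam.smulRight Polynomial.X)

theorem splitHom_ι (lam : V →ₗ[K] K) (a v : V) :
    splitHom lam a (SymmetricAlgebra.ι K V v) =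
      Polynomial.C (SymmetricAlgebra.ι K V (projAlong lam a v)) + lam v • Polynomial.X := by
  simp [splitHom]

/-- Evaluating `t` at `a` gives a left inverse, since `v = π v + lam(v) a`. -/
theorem splitHom_injective (lam : V →ₗ[K] K) (a : V) :
    Function.Injective (splitHom (K := K) lam a) := by
  have h : ((Polynomial.aeval (SymmetricAlgebra.ι K V a) :
      Polynomial (Sym K V) →ₐ[Sym K V] Sym K V).restrictScalars K).comp (splitHom lam a) =
      AlgHom.id K _ := by
    apply SymmetricAlgebra.algHom_ext
    ext v
    simp [splitHom_ι, projAlong_apply]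
  exact Function.LeftInverse.injective (g := Polynomial.aeval (SymmetricAlgebra.ι K V a))
    fun f => DFunLike.congr_fun h f

/-- The expansion of polynomials along the hyperplane `a = 0`. -/
def expandSym (lam : V →ₗ[K] K) (a : V) : Sym K V →+* L⸨X⸩ :=
  (HahnSeries.ofPowerSeries ℤ L).comp <| Polynomial.coeToPowerSeries.ringHom.comp <|
    (Polynomial.mapRingHom (algebraMap (Sym K V) L)).comp (splitHom lam a : Sym K V →+* _)

theorem expandSym_ι (lam : V →ₗ[K] K) (a v : V) :
    expandSym L lam a (SymmetricAlgebra.ι K V v) =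
      HahnSeries.C (vec K L (projAlong lam a v)) +
        HahnSeries.single 1 (algebraMap (Sym K V) L (algebraMap K _ (lam v))) := by
  simp only [expandSym, RingHom.comp_apply, RingHom.coe_coe, splitHom_ι]
  rw [Algebra.smul_def]
  simp [vec]

theorem vec_zero : vec K L (0 : V) = 0 := by simp [vec]

variable (K) in
/-- The `S[V]`-algebra generated by the inverses of the `x i`, `i ∈ D`. -/
def polarAlg (x : Fin N → V) (D : Set (Fin N)) : Subalgebra (Sym K V) L :=
  Algebra.adjoin (Sym K V) ((fun i => (vec K L (x i))⁻¹) '' D)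

theorem vec_inv_mem_polarAlg {x : Fin N → V} {D : Set (Fin N)} {i : Fin N} (hi : i ∈ D) :
    (vec K L (x i))⁻¹ ∈ polarAlg K L x D :=
  Algebra.subset_adjoin ⟨i, hi, rfl⟩

theorem expandSym_mem_laurentSubring (lam : V →ₗ[K] K) (a : V) (A : Subalgebra (Sym K V) L)
    (f : Sym K V) : expandSym L lam a f ∈ laurentSubring A.toSubring := by
  refine coe_mem_laurentSubring fun n => ?_
  rw [RingHom.comp_apply, Polynomial.coeToPowerSeries.ringHom_apply, Polynomial.coeff_coe]
  simp

variable (K) in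
/-- The rational functions that are sums of fractions whose denominators involve vectors `x i`
spanning a proper subspace of the span of the family `x`. -/
def lowPolar (x : Fin N → V) : Submodule (Sym K V) L :=
  ⨆ D : {D : Set (Fin N) //
    Submodule.span K (x '' D) ≠ Submodule.span K (Set.range x)},
    Subalgebra.toSubmodule (polarAlg K L x D.1)

theorem span_image_projAlong (lam : V →ₗ[K] K) (a : V) (x : Fin N → V) (D : Set (Fin N)) :
    Submodule.span K ((fun i => projAlong lam a (x i)) '' D) =
      (Submodule.span K (x '' D)).map (projAlong lam a) := by
  rw [Submodule.map_span, ← Set.image_comp]; rfl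

theorem span_range_projAlong (lam : V →ₗ[K] K) (a : V) (x : Fin N → V) :
    Submodule.span K (Set.range fun i => projAlong lam a (x i)) =
      (Submodule.span K (Set.range x)).map (projAlong lam a) := by
  rw [← Set.image_univ, ← Set.image_univ, span_image_projAlong]

theorem projAlong_eq_zero_iff {lam : V →ₗ[K] K} {a : V} (ha : lam a = 1) {v : V} :
    projAlong lam a v = 0 ↔ v ∈ Submodule.span K {a} := by
  rw [projAlong_apply, Submodule.mem_span_singleton, sub_eq_zero]
  constructor
  · intro h
    exact ⟨lam v, h.symm⟩
  · rintro ⟨c, rfl⟩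
    simp [ha]

theorem ker_projAlong {lam : V →ₗ[K] K} {a : V} (ha : lam a = 1) :
    LinearMap.ker (projAlong lam a) = Submodule.span K {a} := by
  ext v
  rw [LinearMap.mem_ker, projAlong_eq_zero_iff ha]

theorem mem_of_projAlong_mem_map {lam : V →ₗ[K] K} {a : V} (ha : lam a = 1)
    {W : Submodule K V} (haW : a ∈ W) {v : V} (hv : projAlong lam a v ∈ W.map (projAlong lam a)) :
    v ∈ W := by
  obtain ⟨w, hw, hwv⟩ := hv
  have : v - w ∈ Submodule.span K {a} := by
    rw [← projAlong_eq_zero_iff ha, map_sub, hwv, sub_self]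
  rw [← sub_add_cancel v w]
  exact W.add_mem ((Submodule.span_singleton_le_iff_mem a W).2 haW this) hw

variable [IsFractionRing (Sym K V) L]

theorem expandSym_injective (lam : V →ₗ[K] K) (a : V) :
    Function.Injective (expandSym L lam a) :=
  HahnSeries.ofPowerSeries_injective.comp <| (Polynomial.coe_injective L).comp <|
    (Polynomial.map_injective _ (IsFractionRing.injective (Sym K V) L)).comp
      (splitHom_injective lam a)

/-- The Laurent expansion of rational functions along the hyperplane `a = 0`. -/
def expand (lam : V →ₗ[K] K) (a : V) : L →+* L⸨X⸩ :=
  IsFractionRing.lift (expandSym_injective L lam a)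

theorem expand_algebraMap (lam : V →ₗ[K] K) (a : V) (f : Sym K V) :
    expand L lam a (algebraMap _ L f) = expandSym L lam a f :=
  IsFractionRing.lift_algebraMap _ _

theorem expand_vec (lam : V →ₗ[K] K) (a v : V) :
    expand L lam a (vec K L v) = HahnSeries.C (vec K L (projAlong lam a v)) +
        HahnSeries.single 1 (algebraMap (Sym K V) L (algebraMap K _ (lam v))) := by
  rw [vec, expand_algebraMap, expandSym_ι]

theorem ι_injective : Function.Injective (SymmetricAlgebra.ι K V) := by
  rw [injective_iff_map_eq_zero]
  intro v hv
  rw [← Module.forall_dual_apply_eq_zero_iff K]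
  intro f
  rw [← SymmetricAlgebra.lift_ι_apply f v, hv, map_zero]

theorem vec_eq_zero_iff {v : V} : vec K L v = 0 ↔ v = 0 := by
  rw [vec, map_eq_zero_iff _ (IsFractionRing.injective (Sym K V) L),
    map_eq_zero_iff _ ι_injective]

theorem expand_vec_inv_of_ne {lam : V →ₗ[K] K} {a v : V} (hv : projAlong lam a v ≠ 0) :
    expand L lam a (vec K L v)⁻¹ =
      (linearInv (vec K L (projAlong lam a v))
        (algebraMap (Sym K V) L (algebraMap K _ (lam v))) : L⸨X⸩) := by
  rw [map_inv₀, expand_vec, inv_linear ((vec_eq_zero_iff L).not.2 hv)]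

theorem expand_vec_inv_of_eq {lam : V →ₗ[K] K} {a v : V} (hv : projAlong lam a v = 0) :
    expand L lam a (vec K L v)⁻¹ =
      HahnSeries.single (-1) (algebraMap (Sym K V) L (algebraMap K _ (lam v)))⁻¹ := by
  rw [map_inv₀, expand_vec, hv, vec_zero, map_zero, zero_add, HahnSeries.inv_single]

/-- The coefficients of `1 / (u + c t)` involve only powers of `u⁻¹`, with `u` the projected vector;
a vector parallel to `a` contributes a scalar times `t⁻¹`. So expanding introduces no denominators
beyond the projections of the original ones. -/
theorem expand_mem_laurentSubring (lam : V →ₗ[K] K) (a : V) {x : Fin N → V} {D : Set (Fin N)}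
    {z : L} (hz : z ∈ polarAlg K L x D) :
    expand L lam a z ∈ laurentSubring
      (polarAlg K L (fun i => projAlong lam a (x i)) D).toSubring := by
  induction hz using Algebra.adjoin_induction with
  | algebraMap f =>
    rw [expand_algebraMap]
    exact expandSym_mem_laurentSubring L lam a _ f
  | add f g _ _ hf hg => rw [map_add]; exact Subring.add_mem _ hf hg
  | mul f g _ _ hf hg => rw [map_mul]; exact Subring.mul_mem _ hf hg
  | mem z hz =>
    obtain ⟨i, hi, rfl⟩ := hz
    by_cases h : projAlong lam a (x i) = 0
    · simp only [expand_vec_inv_of_eq L h]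
      refine single_mem_laurentSubring ?_
      have := map_inv₀ ((algebraMap (Sym K V) L).comp (algebraMap K (Sym K V))) (lam (x i))
      rw [RingHom.comp_apply, RingHom.comp_apply] at this
      rw [← this]
      exact Subalgebra.algebraMap_mem _ _
    · simp only [expand_vec_inv_of_ne L h]
      refine coe_mem_laurentSubring fun n => ?_
      rw [linearInv, PowerSeries.coeff_mk]
      refine Subring.mul_mem _ (Subring.pow_mem _ (Subring.neg_mem _ ?_) _)
        (Subring.pow_mem _ (vec_inv_mem_polarAlg L hi) _)
      exact Subalgebra.algebraMap_mem _ _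

theorem expand_mem_range {lam : V →ₗ[K] K} {a : V} {x : Fin N → V} {D : Set (Fin N)}
    (hD : ∀ i ∈ D, x i ≠ 0 → projAlong lam a (x i) ≠ 0)
    {z : L} (hz : z ∈ polarAlg K L x D) :
    expand L lam a z ∈ (HahnSeries.ofPowerSeries ℤ L).range := by
  induction hz using Algebra.adjoin_induction with
  | algebraMap f =>
    rw [expand_algebraMap]
    exact ⟨_, rfl⟩
  | add f g _ _ hf hg => rw [map_add]; exact Subring.add_mem _ hf hg
  | mul f g _ _ hf hg => rw [map_mul]; exact Subring.mul_mem _ hf hg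
  | mem z hz =>
    obtain ⟨i, hi, rfl⟩ := hz
    -- Zero vectors have inverse `0` by convention and so create no pole.
    by_cases h : x i = 0
    · simp only [h, vec_zero, inv_zero, map_zero]
      exact Subring.zero_mem _
    · simp only [expand_vec_inv_of_ne L (hD i hi h)]
      exact ⟨_, rfl⟩

/-- Polar coefficients of the expansion along `a` lower the polar order. -/
theorem coeff_expand_mem_lowPolar {lam : V →ₗ[K] K} {a : V} (ha : lam a = 1) {x : Fin N → V}
    {p : ℕ} (hp : 0 < p) {z : L} (hz : z ∈ lowPolar K L x) :
    (expand L lam a z).coeff (-(p : ℤ)) ∈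
      lowPolar K L fun i => projAlong lam a (x i) := by
  refine Submodule.iSup_induction _ (motive := fun z => (expand L lam a z).coeff (-(p : ℤ)) ∈
      lowPolar K L fun i => projAlong lam a (x i)) hz ?_ (by simp) ?_
  · rintro ⟨D, hD⟩ z hz
    -- If no denominator is parallel to `a` there is no pole. Otherwise `a` lies in the span of `D`,
    -- and since the kernel of the projection is spanned by `a`, the span of `D` stays proper after
    -- projecting.
    by_cases h : ∀ i ∈ D, x i ≠ 0 → projAlong lam a (x i) ≠ 0
    · obtain ⟨f, hf⟩ := expand_mem_range L h hz
      rw [← hf, PowerSeries.coeff_coe, if_pos (by omega)]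
      exact Submodule.zero_mem _
    · push Not at h
      obtain ⟨i, hi, hi0, hia⟩ := h
      refine Submodule.mem_iSup_of_mem ⟨D, ?_⟩ (expand_mem_laurentSubring L lam a hz _)
      rw [span_image_projAlong, span_range_projAlong]
      intro h
      apply hD
      refine le_antisymm (Submodule.span_mono (Set.image_subset_range _ _)) fun v hv => ?_
      refine mem_of_projAlong_mem_map ha ?_ (h ▸ Submodule.mem_map_of_mem hv)
      obtain ⟨c, hc⟩ := Submodule.mem_span_singleton.1 ((projAlong_eq_zero_iff ha).1 hia)
      have hc0 : c ≠ 0 := by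
        rintro rfl
        exact hi0 (by rw [← hc, zero_smul])
      rw [← Submodule.smul_mem_iff _ hc0, hc]
      exact Submodule.subset_span ⟨i, hi, rfl⟩
  · intro y z hy hz
    rw [map_add, HahnSeries.coeff_add]
    exact Submodule.add_mem _ hy hz

end Expansion

/-! ### Extracted bases and breaking under projection -/

variable (K) in
/-- `b` is a basis, extracted from the family `x`, of the span of `x`. -/
def IsSpanBasis (x : Fin N → V) (b : Finset (Fin N)) : Prop :=
  LinearIndepOn K x (b : Set (Fin N)) ∧
    Submodule.span K (x '' (b : Set (Fin N))) = Submodule.span K (Set.range x)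

open Classical in
variable (K) in
/-- The positions of the non-zero vectors of `x` that break `b`. -/
def breakers (x : Fin N → V) (b : Finset (Fin N)) : Finset (Fin N) :=
  Finset.univ.filter fun i => x i ≠ 0 ∧ Breaks K x b i

theorem mem_breakers {x : Fin N → V} {b : Finset (Fin N)} {i : Fin N} :
    i ∈ breakers K x b ↔ x i ≠ 0 ∧ Breaks K x b i := by
  simp [breakers]

theorem isSpanBasis_projAlong {lam : V →ₗ[K] K} {x : Fin N → V} {M : Fin N}
    (hlam : lam (x M) = 1) {b : Finset (Fin N)} (hM : M ∈ b) (hb : IsSpanBasis K x b) :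
    IsSpanBasis K (fun i => projAlong lam (x M) (x i)) (b.erase M) := by
  have hbM : (b : Set (Fin N)) = insert M ((b.erase M : Finset (Fin N)) : Set (Fin N)) := by
    rw [← Finset.coe_insert, Finset.insert_erase hM]
  have hM0 : projAlong lam (x M) (x M) = 0 := by simp [projAlong_apply, hlam]
  refine ⟨?_, ?_⟩
  · have hind := hb.1
    rw [hbM, linearIndepOn_insert (by simp)] at hind
    refine LinearIndependent.map hind.1 (f := projAlong lam (x M)) ?_
    rw [ker_projAlong hlam, ← Set.image_eq_range,
      Submodule.disjoint_span_singleton' (by intro h; simp [h] at hlam)]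
    exact hind.2
  · rw [span_range_projAlong, ← hb.2, ← span_image_projAlong, hbM, Set.image_insert_eq, hM0,
      Submodule.span_insert_zero]

/-- As `M` is the last element of `b`, each tail span contains the kernel of the projection, so
membership can be tested after projecting. The tail at `M` projects to zero and breaks no vector
with non-zero projection. -/
theorem breaks_projAlong_iff {lam : V →ₗ[K] K} {x : Fin N → V} {M : Fin N}
    (hlam : lam (x M) = 1) {b : Finset (Fin N)} (hM : M ∈ b) (hbM : ∀ j ∈ b, j ≤ M) {i : Fin N}
    (hi : projAlong lam (x M) (x i) ≠ 0) :
    Breaks K x b i ↔ Breaks K (fun i => projAlong lam (x M) (x i)) (b.erase M) i := by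
  have hM0 : projAlong lam (x M) (x M) = 0 := by simp [projAlong_apply, hlam]
  have hset : ∀ e ≤ M, {j | j ∈ b ∧ e ≤ j} = insert M {j | j ∈ b.erase M ∧ e ≤ j} := by
    intro e he
    ext j
    simp only [Finset.mem_erase, Set.mem_ofPred_eq, Set.mem_insert_iff]
    constructor
    · tauto
    · rintro (rfl | h) <;> tauto
  have hspan : ∀ e ≤ M, (x i ∈ Submodule.span K (x '' {j | j ∈ b ∧ e ≤ j}) ↔
      projAlong lam (x M) (x i) ∈ Submodule.span K
        ((fun i => projAlong lam (x M) (x i)) '' {j | j ∈ b.erase M ∧ e ≤ j})) := by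
    intro e he
    have h0 : Submodule.span K
        ((fun i => projAlong lam (x M) (x i)) '' {j | j ∈ b.erase M ∧ e ≤ j}) =
        (Submodule.span K (x '' {j | j ∈ b ∧ e ≤ j})).map (projAlong lam (x M)) := by
      rw [← span_image_projAlong, hset e he, Set.image_insert_eq, hM0, Submodule.span_insert_zero]
    rw [h0]
    have hMmem : x M ∈ Submodule.span K (x '' {j | j ∈ b ∧ e ≤ j}) :=
      Submodule.subset_span ⟨M, ⟨hM, he⟩, rfl⟩
    exact ⟨fun h => Submodule.mem_map_of_mem h, mem_of_projAlong_mem_map hlam hMmem⟩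
  constructor
  · rintro ⟨e, he, hie, h⟩
    have h' := (hspan e (hbM e he)).1 h
    refine ⟨e, Finset.mem_erase.2 ⟨?_, he⟩, hie, h'⟩
    rintro rfl
    have : {j | j ∈ b.erase e ∧ e ≤ j} = ∅ := by
      ext j
      simp only [Finset.mem_erase, Set.mem_ofPred_eq, Set.mem_empty_iff_false, iff_false]
      rintro ⟨⟨h1, h2⟩, h3⟩
      exact h1 (le_antisymm (hbM j h2) h3)
    rw [this, Set.image_empty, Submodule.span_empty] at h'
    exact hi ((Submodule.mem_bot K).1 h')
  · rintro ⟨e, he, hie, h⟩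
    have heb := (Finset.mem_erase.1 he).2
    exact ⟨e, heb, hie, (hspan e (hbM e heb)).2 h⟩

theorem exists_dual_apply_eq_one {a : V} (ha : a ≠ 0) : ∃ lam : V →ₗ[K] K, lam a = 1 := by
  obtain ⟨f, hf⟩ : ∃ f : Module.Dual K V, f a ≠ 0 := by
    by_contra! h
    exact ha ((Module.forall_dual_apply_eq_zero_iff K a).1 h)
  exact ⟨(f a)⁻¹ • f, by simp [hf]⟩

/-! ### Independence of the polar terms in the fraction field -/

section Independence

variable (L : Type*) [Field L] [Algebra (Sym K V) L]

variable (K V) in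
/-- The embedding of the scalars into a field over `S[V]`. -/
def scalar : K →+* L := (algebraMap (Sym K V) L).comp (algebraMap K (Sym K V))

variable (K) in
/-- The inverse of the product of the elements of `x` that break `b`. -/
def polarTerm (x : Fin N → V) (b : Finset (Fin N)) : L :=
  ∏ i ∈ breakers K x b, (vec K L (x i))⁻¹

theorem lowPolar_eq_bot {x : Fin N → V} (hx : Submodule.span K (Set.range x) = ⊥) :
    lowPolar K L x = ⊥ := by
  rw [lowPolar, iSup_eq_bot]
  rintro ⟨D, hD⟩
  refine absurd ?_ hD
  rw [hx, eq_bot_iff, ← hx]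
  exact Submodule.span_mono (Set.image_subset_range _ _)

variable [IsFractionRing (Sym K V) L]

theorem expand_scalar (lam : V →ₗ[K] K) (a : V) (c : K) :
    expand L lam a (scalar K V L c) = HahnSeries.C (scalar K V L c) := by
  rw [scalar, RingHom.comp_apply, expand_algebraMap]
  simp only [expandSym, RingHom.comp_apply, RingHom.coe_coe, AlgHom.commutes]
  rw [Polynomial.algebraMap_apply]
  simp

theorem coeff_expand_scalar_mul (lam : V →ₗ[K] K) (a : V) (c : K) (z : L) (n : ℤ) :
    (expand L lam a (scalar K V L c * z)).coeff n =
      scalar K V L c * (expand L lam a z).coeff n := by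
  rw [map_mul, expand_scalar, HahnSeries.C_mul_eq_smul, HahnSeries.coeff_smul, smul_eq_mul]

theorem expand_prod_inv_of_eq {lam : V →ₗ[K] K} {a : V} {x : Fin N → V} {B : Finset (Fin N)}
    (hB : ∀ i ∈ B, projAlong lam a (x i) = 0) :
    expand L lam a (∏ i ∈ B, (vec K L (x i))⁻¹) =
      HahnSeries.single (-(B.card : ℤ)) (scalar K V L (∏ i ∈ B, (lam (x i))⁻¹)) := by
  classical
  induction B using Finset.induction_on with
  | empty => simp
  | insert i B hi ih =>
    rw [Finset.prod_insert hi, Finset.prod_insert hi, map_mul,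
      ih fun j hj => hB j (Finset.mem_insert_of_mem hj),
      expand_vec_inv_of_eq L (hB i (Finset.mem_insert_self i B)), HahnSeries.single_mul_single,
      Finset.card_insert_of_notMem hi, map_mul (scalar K V L), map_inv₀ (scalar K V L)]
    congr 2
    push_cast
    ring

-- Factors parallel to `a` give a pure power of `t`; the others give a power series, so the pole
-- order is the number of parallel factors.
open Classical in
theorem expand_prod_inv (lam : V →ₗ[K] K) (a : V) (x : Fin N → V) (B : Finset (Fin N)) :
    expand L lam a (∏ i ∈ B, (vec K L (x i))⁻¹) =
      HahnSeries.single (-((B.filter fun i => projAlong lam a (x i) = 0).card : ℤ))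
        (scalar K V L (∏ i ∈ B.filter fun i => projAlong lam a (x i) = 0, (lam (x i))⁻¹)) *
      ((∏ i ∈ B.filter fun i => projAlong lam a (x i) ≠ 0,
        linearInv (vec K L (projAlong lam a (x i))) (scalar K V L (lam (x i))) : L⟦X⟧) :
          L⸨X⸩) := by
  rw [← Finset.prod_filter_mul_prod_filter_not B (fun i => projAlong lam a (x i) = 0), map_mul]
  congr 1
  · exact expand_prod_inv_of_eq L fun i hi => (Finset.mem_filter.1 hi).2
  · rw [map_prod, map_prod]
    refine Finset.prod_congr rfl fun i hi => ?_
    exact expand_vec_inv_of_ne L (Finset.mem_filter.1 hi).2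

/-- `P` is the set of positions up to `M` carrying vectors parallel to `x M`. All parallel breakers
lie in `P`. If `M ∈ b`, the tail `{M}` makes all of `P` break `b`; otherwise `M` itself does not
break `b`, and the pole order is smaller than `P.card`. -/
theorem coeff_expand_polarTerm {lam : V →ₗ[K] K} {x : Fin N → V} {M : Fin N}
    (hlam : lam (x M) = 1) {P : Finset (Fin N)}
    (hP : ∀ i, i ∈ P ↔ i ≤ M ∧ x i ≠ 0 ∧ projAlong lam (x M) (x i) = 0)
    {b : Finset (Fin N)} (hbM : ∀ j ∈ b, j ≤ M) :
    (expand L lam (x M) (polarTerm K L x b)).coeff (-(P.card : ℤ)) =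
      if M ∈ b then scalar K V L (∏ i ∈ P, (lam (x i))⁻¹) *
        polarTerm K L (fun i => projAlong lam (x M) (x i)) (b.erase M) else 0 := by
  classical
  have hsub : (breakers K x b).filter (fun i => projAlong lam (x M) (x i) = 0) ⊆ P := by
    intro i hi
    obtain ⟨hi, h0⟩ := Finset.mem_filter.1 hi
    obtain ⟨hi0, e, he, hie, -⟩ := mem_breakers.1 hi
    exact (hP i).2 ⟨hie.trans (hbM e he), hi0, h0⟩
  rw [polarTerm, expand_prod_inv, coeff_neg_single_neg_mul_coe _ _ _ _ (Finset.card_le_card hsub)]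
  by_cases hM : M ∈ b
  · have heq : (breakers K x b).filter (fun i => projAlong lam (x M) (x i) = 0) = P := by
      refine hsub.antisymm fun i hi => ?_
      obtain ⟨hiM, hi0, h0⟩ := (hP i).1 hi
      refine Finset.mem_filter.2 ⟨mem_breakers.2 ⟨hi0, M, hM, hiM, ?_⟩, h0⟩
      refine Submodule.span_mono ?_ ((projAlong_eq_zero_iff hlam).1 h0)
      rintro _ rfl
      exact ⟨M, ⟨hM, le_rfl⟩, rfl⟩
    rw [if_pos hM, heq, if_pos rfl, map_prod PowerSeries.constantCoeff]
    congr 1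
    simp only [constantCoeff_linearInv, polarTerm]
    refine Finset.prod_congr ?_ fun _ _ => rfl
    ext i
    rw [Finset.mem_filter, mem_breakers, mem_breakers]
    constructor
    · rintro ⟨⟨-, h⟩, h0⟩
      exact ⟨h0, (breaks_projAlong_iff hlam hM hbM h0).1 h⟩
    · rintro ⟨h0, h⟩
      refine ⟨⟨?_, (breaks_projAlong_iff hlam hM hbM h0).2 h⟩, h0⟩
      intro hx
      simp [hx] at h0
  · rw [if_neg hM, if_neg]
    intro hcard
    have heq := Finset.eq_of_subset_of_card_le hsub hcard.ge
    have hMP : M ∈ P := (hP M).2 ⟨le_rfl, by intro h; simp [h] at hlam,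
      by simp [projAlong_apply, hlam]⟩
    rw [← heq, Finset.mem_filter, mem_breakers] at hMP
    obtain ⟨⟨-, e, he, hMe, -⟩, -⟩ := hMP
    exact hM (le_antisymm (hbM e he) hMe ▸ he)

/-- The inverses of the products of the breaking elements, indexed by the extracted bases, are
linearly independent modulo the functions of lower polar order. -/
theorem eq_zero_of_sum_polarTerm_mem (n : ℕ) (x : Fin N → V) (c : Finset (Fin N) → K)
    (hc : ∀ b, c b ≠ 0 → IsSpanBasis K x b ∧ b.card = n)
    (hsum : ∑ b, scalar K V L (c b) * polarTerm K L x b ∈ lowPolar K L x) : c = 0 := by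
  classical
  induction n generalizing x c with
  | zero =>
    have hc' : ∀ b, b ≠ ∅ → c b = 0 := fun b hb => by
      by_contra h
      exact hb (Finset.card_eq_zero.1 (hc b h).2)
    rw [Finset.sum_eq_single ∅ (fun b _ hb => by rw [hc' b hb, map_zero, zero_mul]) (by simp)]
      at hsum
    funext b
    by_cases hb : b = ∅
    -- Here the family spans zero, so `lowPolar` vanishes and the polar term of the empty basis is
    -- `1`.
    · subst hb
      by_contra h
      have hx : Submodule.span K (Set.range x) = ⊥ := by
        rw [← (hc ∅ h).1.2]; simp
      have h1 : polarTerm K L x ∅ = 1 := by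
        refine Finset.prod_eq_one fun i hi => ?_
        obtain ⟨-, e, he, -⟩ := mem_breakers.1 hi
        simp at he
      rw [lowPolar_eq_bot L hx, h1, mul_one, Submodule.mem_bot, map_eq_zero] at hsum
      exact h hsum
    · exact hc' b hb
  | succ n ih =>
    by_contra hne
    obtain ⟨b₁, hb₁⟩ : ∃ b, c b ≠ 0 := by
      by_contra! h
      exact hne (funext h)
    -- The last position is taken over all bases in the relation at once, so that one expansion
    -- serves every term.
    let U : Finset (Fin N) := (Finset.univ.filter fun b => c b ≠ 0).biUnion id
    have hU : U.Nonempty := by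
      obtain ⟨j, hj⟩ := Finset.card_pos.1 (by rw [(hc b₁ hb₁).2]; omega : 0 < b₁.card)
      exact ⟨j, Finset.mem_biUnion.2 ⟨b₁, by simpa using hb₁, hj⟩⟩
    obtain ⟨M, hMU, hMmax⟩ : ∃ M ∈ U, ∀ j ∈ U, j ≤ M :=
      ⟨U.max' hU, U.max'_mem hU, fun j hj => U.le_max' j hj⟩
    obtain ⟨b₀, hb₀, hMb₀⟩ : ∃ b₀, c b₀ ≠ 0 ∧ M ∈ b₀ := by
      obtain ⟨b₀, hb₀, h⟩ := Finset.mem_biUnion.1 hMU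
      exact ⟨b₀, by simpa using hb₀, h⟩
    have hmax : ∀ b, c b ≠ 0 → ∀ j ∈ b, j ≤ M := fun b hb j hj =>
      hMmax j (Finset.mem_biUnion.2 ⟨b, by simpa using hb, hj⟩)
    have hM0 : x M ≠ 0 := (hc b₀ hb₀).1.1.ne_zero hMb₀
    obtain ⟨lam, hlam⟩ := exists_dual_apply_eq_one (K := K) hM0
    let P : Finset (Fin N) :=
      Finset.univ.filter fun i => i ≤ M ∧ x i ≠ 0 ∧ projAlong lam (x M) (x i) = 0
    have hP : ∀ i, i ∈ P ↔ i ≤ M ∧ x i ≠ 0 ∧ projAlong lam (x M) (x i) = 0 := by simp [P]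
    have hPpos : 0 < P.card := Finset.card_pos.2
      ⟨M, (hP M).2 ⟨le_rfl, hM0, by simp [projAlong_apply, hlam]⟩⟩
    -- The scalar of the leading term, the same for every basis containing `M`.
    let k : K := ∏ i ∈ P, (lam (x i))⁻¹
    have hk : k ≠ 0 := by
      refine Finset.prod_ne_zero_iff.2 fun i hi => inv_ne_zero fun h => ?_
      obtain ⟨-, hi0, hi⟩ := (hP i).1 hi
      rw [projAlong_apply, h, zero_smul, sub_zero] at hi
      exact hi0 hi
    have hcoeff := coeff_expand_mem_lowPolar L hlam hPpos hsum
    -- Coefficients of the projected relation: erasing `M` is a bijection from the sets containing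
    -- `M` to those that do not.
    let c' : Finset (Fin N) → K := fun b => if M ∈ b then 0 else c (insert M b) * k
    have hc' : c' = 0 := by
      refine ih (fun i => projAlong lam (x M) (x i)) c' ?_ ?_
      · intro b hb
        have hMb : M ∉ b := fun h => hb (if_pos h)
        have hb' : c (insert M b) ≠ 0 := by
          intro h
          apply hb
          simp [c', h]
        obtain ⟨h1, h2⟩ := hc _ hb'
        refine ⟨?_, ?_⟩
        · simpa [Finset.erase_insert hMb] using
            isSpanBasis_projAlong hlam (Finset.mem_insert_self M b) h1
        · rw [Finset.card_insert_of_notMem hMb] at h2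
          omega
      · convert hcoeff using 1
        have hterm : (expand L lam (x M)
            (∑ b, scalar K V L (c b) * polarTerm K L x b)).coeff (-(P.card : ℤ)) =
            ∑ b, if M ∈ b then scalar K V L (c b * k) *
              polarTerm K L (fun i => projAlong lam (x M) (x i)) (b.erase M) else 0 := by
          rw [map_sum, HahnSeries.coeff_sum]
          refine Finset.sum_congr rfl fun b _ => ?_
          rw [coeff_expand_scalar_mul]
          by_cases hb : c b = 0
          · simp [hb]
          · rw [coeff_expand_polarTerm L hlam hP (hmax b hb), mul_ite, mul_zero, map_mul, mul_assoc]
        rw [hterm, ← Finset.sum_filter]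
        have hl : ∑ b, scalar K V L (c' b) *
            polarTerm K L (fun i => projAlong lam (x M) (x i)) b =
            ∑ b with M ∉ b, scalar K V L (c' b) *
              polarTerm K L (fun i => projAlong lam (x M) (x i)) b := by
          symm
          refine Finset.sum_filter_of_ne fun b _ hb hMb => hb ?_
          simp [c', hMb]
        rw [hl]
        refine Finset.sum_nbij' (fun b => insert M b) (fun b => b.erase M) ?_ ?_ ?_ ?_ ?_
        · simp
        · simp
        · intro b hb
          exact Finset.erase_insert (by simpa using hb)
        · intro b hb
          exact Finset.insert_erase (by simpa using hb)
        · intro b hb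
          have hMb : M ∉ b := by simpa using hb
          simp [c', hMb]
    have := congrFun hc' (b₀.erase M)
    simp [c', Finset.insert_erase hMb₀, hb₀, hk] at this

end Independence

/-! ### From the fraction field back to polar parts -/

section LinearIndependence

theorem ι_ne_zero {v : V} (hv : v ≠ 0) : SymmetricAlgebra.ι K V v ≠ 0 :=
  (map_ne_zero_iff _ ι_injective).2 hv

theorem algebraMap_dX_ne_zero {X : Fin N → V} (hX0 : ∀ i, X i ≠ 0) :
    algebraMap (Sym K V) (FractionRing (Sym K V)) (dX X) ≠ 0 := by
  rw [map_ne_zero_iff _ (IsFractionRing.injective (Sym K V) (FractionRing (Sym K V)))]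
  rw [dX, prodOf]
  exact Finset.prod_ne_zero_iff.2 fun i _ => ι_ne_zero (K := K) (hX0 i)

variable (K) in
/-- The inclusion of `R_X` into the field of rational functions. -/
def toFrac {X : Fin N → V} (hX0 : ∀ i, X i ≠ 0) : RX K X →+* FractionRing (Sym K V) :=
  IsLocalization.Away.lift (dX X : Sym K V) (algebraMap_dX_ne_zero hX0).isUnit

theorem toFrac_algebraMap {X : Fin N → V} (hX0 : ∀ i, X i ≠ 0) (f : Sym K V) :
    toFrac K hX0 (algebraMap _ (RX K X) f) = algebraMap _ _ f :=
  IsLocalization.Away.lift_eq _ _ _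

theorem toFrac_smul {X : Fin N → V} (hX0 : ∀ i, X i ≠ 0) (f : Sym K V) (z : RX K X) :
    toFrac K hX0 (f • z) = f • toFrac K hX0 z := by
  rw [Algebra.smul_def, map_mul, toFrac_algebraMap, Algebra.smul_def]

/-- As `X` spans `V`, denominators spanning dimension at most `s - 1` span a proper subspace. Only
this inclusion is needed to transport a linear relation. -/
theorem toFrac_mem_lowPolar {X : Fin N → V} (hX0 : ∀ i, X i ≠ 0)
    (hXspan : Submodule.span K (Set.range X) = ⊤) {z : RX K X}
    (hz : z ∈ polarFiltration K X ((Module.finrank K V : ℤ) - 1)) :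
    toFrac K hX0 z ∈ lowPolar K (FractionRing (Sym K V)) X := by
  induction hz using Submodule.span_induction with
  | zero => simp
  | add y z _ _ hy hz => rw [map_add]; exact Submodule.add_mem _ hy hz
  | smul f z _ hz => rw [toFrac_smul]; exact Submodule.smul_mem _ _ hz
  | mem z hz =>
    obtain ⟨f, h, hrank, hz⟩ := hz
    refine Submodule.mem_iSup_of_mem ⟨{i | 0 < h i}, ?_⟩ ?_
    · intro heq
      rw [heq, hXspan, finrank_top] at hrank
      omega
    · have hz' := congrArg (toFrac K hX0) hz
      rw [map_mul, toFrac_algebraMap, toFrac_algebraMap, map_prod] at hz'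
      have hvec : ∀ i, vec K (FractionRing (Sym K V)) (X i) ≠ 0 := fun i =>
        (vec_eq_zero_iff _).not.2 (hX0 i)
      have hne : ∏ i, algebraMap (Sym K V) (FractionRing (Sym K V))
          (SymmetricAlgebra.ι K V (X i) ^ h i) ≠ 0 := by
        refine Finset.prod_ne_zero_iff.2 fun i _ => ?_
        rw [map_pow]
        exact pow_ne_zero _ (hvec i)
      rw [eq_div_of_mul_eq hne hz', div_eq_mul_inv, ← Finset.prod_inv_distrib]
      refine Subalgebra.mul_mem _ (Subalgebra.algebraMap_mem _ _)
        (Subalgebra.prod_mem _ fun i _ => ?_)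
      rw [map_pow, ← inv_pow]
      rcases Nat.eq_zero_or_pos (h i) with hi | hi
      · rw [hi, pow_zero]
        exact Subalgebra.one_mem _
      · exact Subalgebra.pow_mem _ (vec_inv_mem_polarAlg _ hi) _

/-- The vectors that do not break `b` cancel against `d_X`, leaving the breaking ones in the
denominator. -/
theorem toFrac_prodOf_smul_invSelf {X : Fin N → V} (hX0 : ∀ i, X i ≠ 0) (b : Finset (Fin N)) :
    toFrac K hX0 ((prodOf X (breakSet K X b)ᶜ : Sym K V) •
      IsLocalization.Away.invSelf (dX X : Sym K V)) = polarTerm K (FractionRing (Sym K V)) X b := by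
  have hvec : ∀ i, vec K (FractionRing (Sym K V)) (X i) ≠ 0 := fun i =>
    (vec_eq_zero_iff _).not.2 (hX0 i)
  have hinv : toFrac K hX0 (IsLocalization.Away.invSelf (dX X : Sym K V)) =
      (algebraMap (Sym K V) (FractionRing (Sym K V)) (dX X))⁻¹ := by
    refine eq_inv_of_mul_eq_one_right ?_
    rw [← toFrac_algebraMap hX0, ← map_mul, IsLocalization.Away.mul_invSelf, map_one]
  have hbreak : breakers K X b = breakSet K X b := by
    ext i
    simp [breakers, breakSet, hX0]
  rw [toFrac_smul, hinv, Algebra.smul_def, polarTerm, hbreak, dX, prodOf, prodOf, map_prod,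
    map_prod, ← Finset.prod_mul_prod_compl (breakSet K X b), Finset.prod_inv_distrib]
  refine (mul_inv_eq_iff_eq_mul₀ ?_).2 ?_
  · exact mul_ne_zero (Finset.prod_ne_zero_iff.2 fun i _ => hvec i)
      (Finset.prod_ne_zero_iff.2 fun i _ => hvec i)
  · exact (inv_mul_cancel_left₀ (Finset.prod_ne_zero_iff.2 fun i _ => hvec i) _).symm

theorem linearIndependent_uBasis {X : Fin N → V} (hX0 : ∀ i, X i ≠ 0)
    (hXspan : Submodule.span K (Set.range X) = ⊤) :
    LinearIndependent K
      fun b : {b : Finset (Fin N) // IsExtractedBasis K X b} => uBasis K X b.1 := by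
  classical
  rw [Fintype.linearIndependent_iff]
  intro g hg
  have hmem : ∑ b, algebraMap K (Sym K V) (g b) • ((prodOf X (breakSet K X b.1)ᶜ : Sym K V) •
      IsLocalization.Away.invSelf (S := RX K X) (dX X : Sym K V)) ∈
      polarFiltration K X ((Module.finrank K V : ℤ) - 1) := by
    rw [← Submodule.Quotient.mk_eq_zero, ← Submodule.mkQ_apply, map_sum, ← hg]
    refine Finset.sum_congr rfl fun b _ => ?_
    rw [map_smul, map_smul, algebraMap_smul]
    rfl
  have hmem' := toFrac_mem_lowPolar hX0 hXspan hmem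
  let c : Finset (Fin N) → K := fun b => if h : IsExtractedBasis K X b then g ⟨b, h⟩ else 0
  have hc : c = 0 := by
    refine eq_zero_of_sum_polarTerm_mem (FractionRing (Sym K V)) (Module.finrank K V) X c ?_ ?_
    · intro b hb
      have hb' : IsExtractedBasis K X b := by
        by_contra h
        exact hb (dif_neg h)
      refine ⟨⟨hb'.1, by rw [hb'.2, hXspan]⟩, ?_⟩
      have hcard := finrank_span_eq_card hb'.1
      rw [← Set.image_eq_range, hb'.2, finrank_top] at hcard
      simpa using hcard.symm
    · convert hmem' using 1
      rw [map_sum, ← Finset.sum_filter_of_ne (p := fun b => IsExtractedBasis K X b),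
        Finset.sum_subtype (p := fun b => IsExtractedBasis K X b) _ (by simp)]
      · refine Finset.sum_congr rfl fun b _ => ?_
        rw [toFrac_smul, toFrac_prodOf_smul_invSelf, Algebra.smul_def]
        simp [c, b.2, scalar]
      · intro b _ hb
        by_contra h
        exact hb (by simp [c, h])
  intro b
  have := congrFun hc b.1
  simpa [c, b.2] using this

end LinearIndependence

/-! ### Gradings as eigenspaces of the scaling by 2 -/

section Grading

variable (K V) in
/-- The automorphism of `S[V]` that multiplies vectors by `2`. -/
def dbl : Sym K V →ₐ[K] Sym K V := SymmetricAlgebra.lift ((2 : K) • SymmetricAlgebra.ι K V)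

theorem dbl_ι (v : V) :
    dbl K V (SymmetricAlgebra.ι K V v) = (2 : K) • SymmetricAlgebra.ι K V v := by
  simp [dbl]

theorem dbl_of_mem_pow {n : ℕ} {f : Sym K V}
    (hf : f ∈ LinearMap.range (SymmetricAlgebra.ι K V) ^ n) : dbl K V f = (2 : K) ^ n • f := by
  induction n generalizing f with
  | zero =>
    rw [pow_zero, Submodule.mem_one] at hf
    obtain ⟨c, rfl⟩ := hf
    simp
  | succ n ih =>
    rw [pow_succ] at hf
    induction hf using Submodule.mul_induction_on' with
    | mem_mul_mem g hg h hh =>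
      obtain ⟨v, rfl⟩ := hh
      rw [map_mul, ih hg, dbl_ι, smul_mul_smul_comm, pow_succ]
    | add g _ h _ hg hh => rw [map_add, hg, hh, smul_add]

theorem dbl_prod_pow (X : Fin N → V) (h : Fin N → ℕ) :
    dbl K V (∏ i, SymmetricAlgebra.ι K V (X i) ^ h i) =
      (2 : K) ^ (∑ i, h i) • ∏ i, SymmetricAlgebra.ι K V (X i) ^ h i := by
  simp only [map_prod, map_pow, dbl_ι, smul_pow]
  rw [Finset.prod_smul, Finset.prod_pow_eq_pow_sum]

theorem dbl_dX (X : Fin N → V) : dbl K V (dX X) = (2 : K) ^ N • dX X := by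
  simpa [dX, prodOf] using dbl_prod_pow (K := K) X fun _ => 1

theorem isUnit_algebraMap_of_ne_zero {R A : Type*} [Field R] [CommRing A] [Algebra R A] {c : R}
    (hc : c ≠ 0) : IsUnit (algebraMap R A c) :=
  (IsUnit.mk0 c hc).map _

variable [CharZero K]

theorem isUnit_dbl_dX (X : Fin N → V) :
    IsUnit (((algebraMap (Sym K V) (RX K X)).comp (dbl K V : Sym K V →+* Sym K V)) (dX X)) := by
  rw [RingHom.comp_apply, RingHom.coe_coe, dbl_dX, Algebra.smul_def, map_mul]
  refine IsUnit.mul ?_ (IsLocalization.Away.algebraMap_isUnit _)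
  exact (isUnit_algebraMap_of_ne_zero (A := Sym K V) (c := (2 : K) ^ N) (by simp)).map _

variable (K) in
/-- The automorphism of `R_X` that multiplies vectors by `2`. -/
def dblRX (X : Fin N → V) : RX K X →+* RX K X :=
  IsLocalization.Away.lift (dX X : Sym K V) (isUnit_dbl_dX X)

theorem dblRX_algebraMap (X : Fin N → V) (f : Sym K V) :
    dblRX K X (algebraMap _ (RX K X) f) = algebraMap _ _ (dbl K V f) :=
  IsLocalization.Away.lift_eq _ _ _

variable (K) in
/-- `dblRX` as a semilinear map over `dbl`. -/
def dblRXₛₗ (X : Fin N → V) : RX K X →ₛₗ[(dbl K V : Sym K V →+* Sym K V)] RX K X where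
  toFun := dblRX K X
  map_add' := map_add _
  map_smul' f z := by
    rw [Algebra.smul_def, map_mul, dblRX_algebraMap, Algebra.smul_def]
    rfl

theorem polarFiltration_le_comap (X : Fin N → V) (k : ℤ) :
    polarFiltration K X k ≤ (polarFiltration K X k).comap (dblRXₛₗ K X) := by
  conv_lhs => rw [polarFiltration]
  rw [Submodule.span_le]
  rintro z ⟨f, h, hk, hz⟩
  -- Scaling multiplies the denominator by a power of `2`, which is moved to the numerator; the
  -- exponents `h` are kept.
  refine Submodule.subset_span
    ⟨((2 : K) ^ (∑ i, h i))⁻¹ • dbl K V f, h, hk, ?_⟩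
  have hz' := congrArg (dblRX K X) hz
  rw [map_mul, dblRX_algebraMap, dblRX_algebraMap, dbl_prod_pow] at hz'
  have h2 : (2 : K) ^ (∑ i, h i) ≠ 0 := by simp
  have key : dbl K V f = algebraMap K (Sym K V) ((2 : K) ^ (∑ i, h i)) *
      (((2 : K) ^ (∑ i, h i))⁻¹ • dbl K V f) := by
    rw [← Algebra.smul_def, smul_smul, mul_inv_cancel₀ h2, one_smul]
  rw [key, Algebra.smul_def ((2 : K) ^ (∑ i, h i)) (∏ i, _), map_mul, map_mul,
    mul_left_comm] at hz'
  exact ((isUnit_algebraMap_of_ne_zero (A := Sym K V) h2).map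
    (algebraMap (Sym K V) (RX K X))).mul_left_cancel hz'

variable (K) in
/-- The operator on `P_X` induced by multiplying vectors by `2`. -/
def dblPX (X : Fin N → V) : Module.End K (PX K X) where
  toFun := Submodule.mapQ _ _ (dblRXₛₗ K X) (polarFiltration_le_comap X _)
  map_add' := map_add _
  map_smul' c z := by
    rw [← algebraMap_smul (Sym K V) c z, LinearMap.map_smulₛₗ, RingHom.coe_coe, AlgHom.commutes,
      algebraMap_smul]
    rfl

theorem dblPX_mkQ (X : Fin N → V) (z : RX K X) :
    dblPX K X ((polarFiltration K X ((Module.finrank K V : ℤ) - 1)).mkQ z) =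
      (polarFiltration K X ((Module.finrank K V : ℤ) - 1)).mkQ (dblRX K X z) := rfl

theorem dblRX_of_mem_RXDegree {X : Fin N → V} {j : ℤ} {z : RX K X} (hz : z ∈ RXDegree K X j) :
    dblRX K X z = (2 : K) ^ j • z := by
  induction hz using Submodule.span_induction with
  | zero => simp
  | add y z _ _ hy hz => rw [map_add, hy, hz, smul_add]
  | smul c z _ hz =>
    rw [← algebraMap_smul (Sym K V) c z, Algebra.smul_def, map_mul, dblRX_algebraMap,
      AlgHom.commutes, hz, ← Algebra.smul_def, smul_comm, ← Algebra.smul_def]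
  | mem z hz =>
    obtain ⟨m, f, hf, hz⟩ := hz
    have hu : IsUnit (algebraMap (Sym K V) (RX K X) (dX X ^ m)) := by
      rw [map_pow]
      exact (IsLocalization.Away.algebraMap_isUnit _).pow m
    have hdf : dbl K V f = (2 : K) ^ (j + m * N) • f := by
      unfold symDegree at hf
      split_ifs at hf with h
      · rw [dbl_of_mem_pow hf, ← zpow_natCast, Int.toNat_of_nonneg h]
      · rw [(Submodule.mem_bot K).1 hf]; simp
    have hz' := congrArg (dblRX K X) hz
    have h2 : (2 : K) ^ (m * N) ≠ 0 := by simp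
    rw [map_mul, dblRX_algebraMap, dblRX_algebraMap, hdf, map_pow, dbl_dX, smul_pow, ← pow_mul,
      mul_comm N m, zpow_add₀ two_ne_zero] at hz'
    rw [show (2 : K) ^ ((m : ℤ) * N) = (2 : K) ^ (m * N) by rw [← zpow_natCast]; push_cast; rfl,
      mul_comm ((2 : K) ^ j), mul_smul, Algebra.smul_def ((2 : K) ^ (m * N)),
      Algebra.smul_def ((2 : K) ^ (m * N)), map_mul, map_mul, mul_left_comm] at hz'
    have hz'' := ((isUnit_algebraMap_of_ne_zero (A := Sym K V) h2).map
      (algebraMap (Sym K V) (RX K X))).mul_left_cancel hz'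
    refine hu.mul_right_cancel (hz''.trans ?_)
    rw [Algebra.smul_def, map_mul, ← hz, ← mul_assoc, ← Algebra.smul_def, algebraMap_smul]

theorem zpow_two_injective : Function.Injective fun j : ℤ => (2 : K) ^ j := by
  intro i j hij
  have : ((2 ^ i : ℚ) : K) = ((2 ^ j : ℚ) : K) := by push_cast; exact hij
  exact zpow_right_injective₀ (by norm_num) (by norm_num) (Rat.cast_injective this)

/-- Degree `j` lies in the eigenspace of `dblPX` for `2 ^ (j - N)`, the shift by `N` being that of
the grading of `P_X`; distinct eigenvalues have independent eigenspaces. -/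
theorem iSupIndep_PXDegree (X : Fin N → V) : iSupIndep (PXDegree K X) := by
  have hinj : Function.Injective fun j : ℤ => (2 : K) ^ (j - N) :=
    zpow_two_injective.comp (sub_left_injective)
  refine ((dblPX K X).eigenspaces_iSupIndep.comp hinj).mono fun j => ?_
  rintro _ ⟨z, hz, rfl⟩
  rw [Function.comp_apply, Module.End.mem_eigenspace_iff]
  change dblPX K X ((polarFiltration K X _).mkQ z) = (2 : K) ^ (j - N) • (Submodule.mkQ _ z)
  rw [dblPX_mkQ, dblRX_of_mem_RXDegree hz]
  rfl

end Grading

section Submodules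

variable {R M M' ι : Type*} [Ring R] [AddCommGroup M] [Module R M] [AddCommGroup M'] [Module R M']

theorem iSupIndep_of_le_comap {f : M →ₗ[R] M'} (hf : Function.Injective f)
    {A : ι → Submodule R M} {B : ι → Submodule R M'} (hB : iSupIndep B)
    (hAB : ∀ i, A i ≤ (B i).comap f) : iSupIndep A := by
  intro i
  rw [Submodule.disjoint_def]
  intro m hm hm'
  refine hf ?_
  rw [map_zero]
  refine Submodule.disjoint_def.1 (hB i) _ (hAB i hm) ?_
  have := Submodule.mem_map_of_mem (f := f) hm'
  simp only [Submodule.map_iSup] at this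
  exact (iSup₂_mono fun j _ => Submodule.map_le_iff_le_comap.2 (hAB j)) this

/-- Makes `A_X ≃ Q_X` graded: the images of the pieces of `A_X` already fill `Q_X`, and the pieces
of `Q_X` are independent, so no piece can be strictly larger. -/
theorem eq_of_le_of_iSup_eq_top {A B : ι → Submodule R M} (hB : iSupIndep B)
    (hAB : ∀ i, A i ≤ B i) (hA : ⨆ i, A i = ⊤) (i : ι) : A i = B i := by
  refine le_antisymm (hAB i) fun m hm => ?_
  have hmem : m ∈ A i ⊔ ⨆ (j) (_ : j ≠ i), A j := by
    have : ⨆ j, A j ≤ A i ⊔ ⨆ (j) (_ : j ≠ i), A j := by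
      refine iSup_le fun j => ?_
      by_cases h : j = i
      · subst h; exact le_sup_left
      · exact le_sup_of_le_right (le_iSup₂_of_le j h le_rfl)
    exact this (hA ▸ Submodule.mem_top)
  obtain ⟨y, hy, z, hz, rfl⟩ := Submodule.mem_sup.1 hmem
  have hz0 : z = 0 := by
    refine Submodule.disjoint_def.1 (hB i) z ?_ ((iSup₂_mono fun j _ => hAB j) hz)
    simpa using (B i).sub_mem hm (hAB i hy)
  rwa [hz0, add_zero]

end Submodules

/-! ### Annihilator, isomorphism and basis -/

theorem iSup_symDegree : ⨆ j, symDegree K V j = ⊤ := by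
  have hle : ∀ n : ℕ, LinearMap.range (SymmetricAlgebra.ι K V) ^ n ≤ ⨆ j, symDegree K V j :=
    fun n => le_iSup_of_le (n : ℤ) (by simp [symDegree])
  have hmul : (⨆ j, symDegree K V j) * (⨆ j, symDegree K V j) ≤ ⨆ j, symDegree K V j := by
    rw [Submodule.iSup_mul]
    refine iSup_le fun i => ?_
    rw [Submodule.mul_iSup]
    refine iSup_le fun j => ?_
    unfold symDegree
    split_ifs
    · rw [← pow_add]; exact hle _
    · simp
    · simp
    · simp
  rw [eq_top_iff]
  intro f _
  induction f using SymmetricAlgebra.induction with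
  | algebraMap r => exact hle 0 (by rw [pow_zero]; exact Submodule.algebraMap_mem r)
  | ι v => exact hle 1 (by rw [pow_one]; exact ⟨v, rfl⟩)
  | mul f g hf hg => exact hmul (Submodule.mul_mem_mul (hf trivial) (hg trivial))
  | add f g hf hg => exact Submodule.add_mem _ (hf trivial) (hg trivial)

theorem iSup_AXDegree (X : Fin N → V) : ⨆ j, AXDegree K X j = ⊤ := by
  simp only [AXDegree]
  rw [← Submodule.map_iSup, iSup_symDegree, Submodule.map_top, LinearMap.range_eq_top]
  exact Ideal.Quotient.mk_surjective

theorem smul_uX_mem_PXDegree (X : Fin N → V) {j : ℤ} {f : Sym K V} (hf : f ∈ symDegree K V j) :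
    f • uX K X ∈ PXDegree K X j := by
  refine ⟨f • IsLocalization.Away.invSelf (dX X : Sym K V), ?_, rfl⟩
  refine Submodule.subset_span ⟨1, f, by simpa using hf, ?_⟩
  rw [pow_one, Algebra.smul_def, mul_assoc, mul_comm _ (algebraMap _ _ (dX X)),
    IsLocalization.Away.mul_invSelf, mul_one]

theorem cocircuitIdeal_le_torsionOf [FiniteDimensional K V] (X : Fin N → V) :
    cocircuitIdeal X ≤ Ideal.torsionOf (Sym K V) (PX K X) (uX K X) := by
  classical
  rw [cocircuitIdeal, Ideal.span_le]
  rintro _ ⟨Y, hY, rfl⟩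
  rw [SetLike.mem_coe, Ideal.mem_torsionOf_iff, uX, ← map_smul, Submodule.mkQ_apply,
    Submodule.Quotient.mk_eq_zero]
  refine Submodule.subset_span ⟨1, fun i => if i ∈ Y then 0 else 1, ?_, ?_⟩
  · have hset : {i | 0 < if i ∈ Y then 0 else 1} = {i | i ∉ Y} := by
      ext i
      by_cases h : i ∈ Y <;> simp [h]
    rw [hset]
    have := Submodule.finrank_lt hY
    omega
  · have hprod : ∏ i, SymmetricAlgebra.ι K V (X i) ^ (if i ∈ Y then 0 else 1) =
        prodOf X Yᶜ := by
      rw [prodOf, ← Finset.prod_mul_prod_compl Y, Finset.prod_eq_one, one_mul]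
      · refine Finset.prod_congr rfl fun i hi => ?_
        rw [if_neg (Finset.mem_compl.1 hi), pow_one]
      · intro i hi
        rw [if_pos hi, pow_zero]
    rw [hprod, Algebra.smul_def, mul_right_comm, ← map_mul, prodOf, prodOf,
      Finset.prod_mul_prod_compl, map_one]
    exact IsLocalization.Away.mul_invSelf (dX X : Sym K V)

/-- A normal form modulo `I_X`; since `I_X` kills `u_X`, the same coefficients express `f u_X`
through the `u_b`. -/
theorem exists_sub_sum_mem_cocircuitIdeal [FiniteDimensional K V] {X : Fin N → V}
    (hX0 : ∀ i, X i ≠ 0) (f : Sym K V) :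
    ∃ g : {b : Finset (Fin N) // IsExtractedBasis K X b} → K,
      f - ∑ᶠ b, g b • (prodOf X (breakSet K X b.1)ᶜ : Sym K V) ∈ cocircuitIdeal X ∧
      f • uX K X = ∑ᶠ b, g b • uBasis K X b.1 := by
  classical
  have hf : f ∈ Submodule.span K
      (Set.range fun b : {b : Finset (Fin N) // IsExtractedBasis K X b} =>
        (prodOf X (breakSet K X b.1)ᶜ : Sym K V)) ⊔
      (cocircuitIdeal X : Ideal (Sym K V)).restrictScalars K := by
    rw [span_prodOf_compl_breakSet_sup_cocircuitIdeal X hX0]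
    trivial
  obtain ⟨m, hm, r, hr, rfl⟩ := Submodule.mem_sup.1 hf
  obtain ⟨g, rfl⟩ := (Submodule.mem_span_range_iff_exists_fun K).1 hm
  refine ⟨g, ?_, ?_⟩
  · rw [finsum_eq_sum_of_fintype, add_sub_cancel_left]
    exact hr
  · have hr0 : r • uX K X = 0 := cocircuitIdeal_le_torsionOf X hr
    rw [finsum_eq_sum_of_fintype, add_smul, hr0, add_zero, Finset.sum_smul]
    refine Finset.sum_congr rfl fun b _ => ?_
    rw [uBasis, smul_assoc]

/-- If `f u_X = 0`, independence of the `u_b` forces the normal form of `f` to vanish. -/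
theorem torsionOf_uX [FiniteDimensional K V] {X : Fin N → V} (hX0 : ∀ i, X i ≠ 0)
    (hXspan : Submodule.span K (Set.range X) = ⊤) :
    Ideal.torsionOf (Sym K V) (PX K X) (uX K X) = cocircuitIdeal X := by
  classical
  refine le_antisymm (fun f hf => ?_) (cocircuitIdeal_le_torsionOf X)
  obtain ⟨g, hg, hgu⟩ := exists_sub_sum_mem_cocircuitIdeal hX0 f
  rw [Ideal.mem_torsionOf_iff] at hf
  rw [hf, finsum_eq_sum_of_fintype] at hgu
  have hg0 := Fintype.linearIndependent_iff.1 (linearIndependent_uBasis hX0 hXspan) g hgu.symm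
  simpa [hg0] using hg

/-- The isomorphism `A_X ≃ Q_X` induced by `f ↦ f u_X`. -/
def equivQX [FiniteDimensional K V] {X : Fin N → V} (hX0 : ∀ i, X i ≠ 0)
    (hXspan : Submodule.span K (Set.range X) = ⊤) : AX K X ≃ₗ[Sym K V] QX K X :=
  (Submodule.quotEquivOfEq _ _ (torsionOf_uX hX0 hXspan).symm).trans
    (Ideal.quotTorsionOfEquivSpanSingleton (Sym K V) (PX K X) (uX K X))

theorem coe_equivQX_mk [FiniteDimensional K V] {X : Fin N → V} (hX0 : ∀ i, X i ≠ 0)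
    (hXspan : Submodule.span K (Set.range X) = ⊤) (f : Sym K V) :
    (equivQX hX0 hXspan (Ideal.Quotient.mk (cocircuitIdeal X) f) : PX K X) = f • uX K X := rfl

theorem map_AXDegree_le [FiniteDimensional K V] {X : Fin N → V} (hX0 : ∀ i, X i ≠ 0)
    (hXspan : Submodule.span K (Set.range X) = ⊤) (j : ℤ) :
    (AXDegree K X j).map ((equivQX hX0 hXspan).toLinearMap.restrictScalars K) ≤
      QXDegree K X j := by
  rintro _ ⟨_, ⟨f, hf, rfl⟩, rfl⟩
  exact smul_uX_mem_PXDegree X hf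

theorem iSup_map_AXDegree [FiniteDimensional K V] {X : Fin N → V} (hX0 : ∀ i, X i ≠ 0)
    (hXspan : Submodule.span K (Set.range X) = ⊤) :
    ⨆ j, (AXDegree K X j).map ((equivQX hX0 hXspan).toLinearMap.restrictScalars K) = ⊤ := by
  rw [← Submodule.map_iSup, iSup_AXDegree, Submodule.map_top, LinearMap.range_eq_top]
  exact (equivQX hX0 hXspan).surjective

theorem iSupIndep_QXDegree [CharZero K] (X : Fin N → V) : iSupIndep (QXDegree K X) :=
  iSupIndep_of_le_comap (f := (QX K X).subtype.restrictScalars K) (QX K X).injective_subtype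
    (iSupIndep_PXDegree X) fun _ => le_rfl

theorem uBasis_mem_QX (X : Fin N → V) (b : Finset (Fin N)) : uBasis K X b ∈ QX K X :=
  Submodule.smul_mem _ _ (Submodule.mem_span_singleton_self _)

/-- The basis of `Q_X` formed by the elements `u_b`. -/
def basisQX [FiniteDimensional K V] {X : Fin N → V} (hX0 : ∀ i, X i ≠ 0)
    (hXspan : Submodule.span K (Set.range X) = ⊤) :
    Module.Basis {b : Finset (Fin N) // IsExtractedBasis K X b} K (QX K X) :=
  Module.Basis.mk (v := fun b => ⟨uBasis K X b.1, uBasis_mem_QX X b.1⟩)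
    (LinearIndependent.of_comp ((QX K X).subtype.restrictScalars K)
      (linearIndependent_uBasis hX0 hXspan)) <| by
    classical
    rintro ⟨q, hq⟩ -
    obtain ⟨f, rfl⟩ := Submodule.mem_span_singleton.1 hq
    obtain ⟨g, -, hg⟩ := exists_sub_sum_mem_cocircuitIdeal hX0 f
    refine (Submodule.mem_span_range_iff_exists_fun K).2 ⟨g, Subtype.ext ?_⟩
    rw [finsum_eq_sum_of_fintype] at hg
    refine Eq.trans ?_ hg.symm
    rw [AddSubmonoidClass.coe_finsetSum]
    rfl

end

end PolarParts

theorem mainTheorem2 {K V : Type*} [Field K] [CharZero K] [AddCommGroup V] [Module K V]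
    [FiniteDimensional K V] {N : ℕ} (X : Fin N → V)
    (hX0 : ∀ i, X i ≠ 0) (hXspan : Submodule.span K (Set.range X) = ⊤) :
    Ideal.torsionOf (PolarParts.Sym K V) (PolarParts.PX K X) (PolarParts.uX K X) =
        PolarParts.cocircuitIdeal X ∧
      DirectSum.IsInternal (PolarParts.AXDegree K X) ∧
      DirectSum.IsInternal (PolarParts.QXDegree K X) ∧
      (∃ φ : PolarParts.AX K X ≃ₗ[PolarParts.Sym K V] PolarParts.QX K X,
        (∀ f : PolarParts.Sym K V,
          (φ (Ideal.Quotient.mk (PolarParts.cocircuitIdeal X) f) : PolarParts.PX K X) =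
            f • PolarParts.uX K X) ∧
        ∀ j : ℤ, (PolarParts.AXDegree K X j).map (φ.toLinearMap.restrictScalars K) =
          PolarParts.QXDegree K X j) ∧
      ∃ β : Module.Basis {b : Finset (Fin N) // PolarParts.IsExtractedBasis K X b} K
          (PolarParts.QX K X),
        ∀ b, (β b : PolarParts.PX K X) = PolarParts.uBasis K X b.1 := by
  classical
  refine ⟨PolarParts.torsionOf_uX hX0 hXspan, ?_, ?_,
    ⟨PolarParts.equivQX hX0 hXspan, PolarParts.coe_equivQX_mk hX0 hXspan, fun j => ?_⟩,
    PolarParts.basisQX hX0 hXspan, fun b => ?_⟩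
  · refine DirectSum.isInternal_submodule_of_iSupIndep_of_iSup_eq_top ?_
      (PolarParts.iSup_AXDegree X)
    -- Independence in `A_X` is pulled back from `Q_X` along the isomorphism, so homogeneity of
    -- `I_X` need not be checked directly.
    exact PolarParts.iSupIndep_of_le_comap
      (f := (PolarParts.equivQX hX0 hXspan).toLinearMap.restrictScalars K)
      (PolarParts.equivQX hX0 hXspan).injective (PolarParts.iSupIndep_QXDegree X)
      fun j => Submodule.map_le_iff_le_comap.1 (PolarParts.map_AXDegree_le hX0 hXspan j)
  · refine DirectSum.isInternal_submodule_of_iSupIndep_of_iSup_eq_top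
      (PolarParts.iSupIndep_QXDegree X) ?_
    rw [eq_top_iff, ← PolarParts.iSup_map_AXDegree hX0 hXspan]
    exact iSup_mono (PolarParts.map_AXDegree_le hX0 hXspan)
  · exact PolarParts.eq_of_le_of_iSup_eq_top (PolarParts.iSupIndep_QXDegree X)
      (PolarParts.map_AXDegree_le hX0 hXspan) (PolarParts.iSup_map_AXDegree hX0 hXspan) j
  · rw [PolarParts.basisQX, Module.Basis.mk_apply]
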